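/- Conventions. Let $R$ be a commutative ring and let $q\in R$ be invertible (for instance $R=\mathbb C[q,q^{-1}]$). Let $\mathbf{Sym}=R\langle S_1,S_2,\dots\rangle$ be the algebra of noncommutative symmetric functions over $R$ (the free associative algebra on the $S_n=S_n(A)$, $n\ge 1$), with $S_0=1$. For a composition $I=(i_1,\dots,i_p)$ put $S^I=S_{i_1}\cdots S_{i_p}$, and let $R_I=\sum_{J}(-1)^{\ell(I)-\ell(J)}S^J$ be the ribbon functions, the sum being over the compositions $J$ coarser than or equal to $I$. Put $\sigma_t(cA)=\sum_{n\ge0}t^nc^nS_n(A)$, and for $m\in\mathbb Z$ define $S_n([m]_qA)$ by $\sum_{n\ge0}t^nS_n([m]_qA)=\sigma_t([m]_qA)$, where $\sigma_t([m]_qA)=\sigma_t(A)\sigma_t(qA)\cdots\sigma_t(q^{m-1}A)$ if $m\ge0$ and $\sigma_t([-k]_qA)=\sigma_t(q^{-1}A)^{-1}\sigma_t(q^{-2}A)^{-1}\cdots\sigma_t(q^{-k}A)^{-1}$ if $k>0$. Let $H_n(0)$ be the $0$-Hecke algebra over $\mathbb C$, generated by $T_1,\dots,T_{n-1}$ subject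 to $T_i^2=-T_i$, $T_iT_j=T_jT_i$ for $|i-j|\ge2$, and $T_iT_{i+1}T_i=T_{i+1}T_iT_{i+1}$. It acts on the right on linear combinations of words $w=a_1\cdots a_n$ of positive integers by: $w\cdot T_i=a_1\cdots a_{i+1}a_i\cdots a_n$ if $a_i<a_{i+1}$, $w\cdot T_i=0$ if $a_i=a_{i+1}$, and $w\cdot T_i=-w$ if $a_i>a_{i+1}$. For a composition $I=(i_1,\dots,i_p)$ of $n$, let $C_I$ be the one-dimensional right module on which $T_i$ acts by $-1$ if $i\in\{i_1,\,i_1+i_2,\dots,i_1+\cdots+i_{p-1}\}$ and by $0$ otherwise, and let $P_I$ be its projective cover. The noncommutative characteristic of a finitely generated projective right $H_n(0)$-module $M$ is $\mathbf{ch}(M)=\sum_{I\vDash n}\dim\operatorname{Hom}_{H_n(0)}(M,C_I)\,R_I$; that is, $\mathbf{ch}$ is additive and $\mathbf{ch}(P_I)=R_I$. A parking function of length $n$ is a word $a_1\cdots a_n$ of positive integers whose nondecreasing rearrangement $a'_1\cdots a'_n$ satisfies $a'_i\le i$ for all $i$. For $d\ge0$ let $\mathrm{PF}_{n}^{(d)}$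 be the right $H_n(0)$-module spanned by the parking functions of length $n$ with $\sum_i(a_i-1)=d$, and let $$G_n(q;A)=\mathbf{ch}_q(\mathrm{PF}_n)=\sum_{d\ge0}q^d\,\mathbf{ch}\bigl(\mathrm{PF}_n^{(d)}\bigr).$$ For $r\in\mathbb Z$ let $$F^{(r)}(x,q;A)=\sum_{n\ge0}x^nq^{-\binom n2}S_n([n+r]_qA)\in\mathbf{Sym}[[x]].$$ Theorem. All the modules $\mathrm{PF}_n^{(d)}$ are projective, and for every integer $r$ the series $F^{(r-1)}(x,q;A)$ is invertible in $\mathbf{Sym}[[x]]$ and $$\sum_{n\ge0}x^nq^{-\binom{n+1}2}G_n(q;A)=F^{(r)}(xq^{-1},q;A)\;F^{(r-1)}(x,q;A)^{-1}.$$ In particular, the right-hand side does not depend on $r$. -/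

import Mathlib

noncomputable section

namespace ParkingHecke

/-! ## The 0-Hecke algebra -/

/-- Defining relations of the 0-Hecke algebra: `T_i² = -T_i` together with the commutation and
braid relations. -/
inductive HeckeRel (n : ℕ) :
    FreeAlgebra ℂ (Fin (n - 1)) → FreeAlgebra ℂ (Fin (n - 1)) → Prop
  | quad (i : Fin (n - 1)) :
      HeckeRel n (FreeAlgebra.ι ℂ i * FreeAlgebra.ι ℂ i) (-FreeAlgebra.ι ℂ i)
  | comm (i j : Fin (n - 1)) (h : (i : ℕ) + 1 < j) :
      HeckeRel n (FreeAlgebra.ι ℂ i * FreeAlgebra.ι ℂ j) (FreeAlgebra.ι ℂ j * FreeAlgebra.ι ℂ i)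
  | braid (i j : Fin (n - 1)) (h : (i : ℕ) + 1 = j) :
      HeckeRel n (FreeAlgebra.ι ℂ i * FreeAlgebra.ι ℂ j * FreeAlgebra.ι ℂ i)
        (FreeAlgebra.ι ℂ j * FreeAlgebra.ι ℂ i * FreeAlgebra.ι ℂ j)

/-- The 0-Hecke algebra `H_n(0)` over `ℂ`. A right `H_n(0)`-module is a module
over `(HeckeZero n)ᵐᵒᵖ`. -/
abbrev HeckeZero (n : ℕ) : Type := RingQuot (HeckeRel n)

/-- The generator `T_{i+1}` of `H_n(0)`, for `0 ≤ i < n - 1`. -/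
def T {n : ℕ} (i : Fin (n - 1)) : HeckeZero n :=
  RingQuot.mkAlgHom ℂ (HeckeRel n) (FreeAlgebra.ι ℂ i)

/-- Universal property of `H_n(0)`. -/
def heckeLift {n : ℕ} {B : Type} [Ring B] [Algebra ℂ B] (t : Fin (n - 1) → B)
    (quad : ∀ i, t i * t i = -t i)
    (comm : ∀ i j : Fin (n - 1), (i : ℕ) + 1 < j → t i * t j = t j * t i)
    (braid : ∀ i j : Fin (n - 1), (i : ℕ) + 1 = j → t i * t j * t i = t j * t i * t j) :
    HeckeZero n →ₐ[ℂ] B :=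
  RingQuot.liftAlgHom ℂ ⟨FreeAlgebra.lift ℂ t, by
    intro x y h
    cases h with
    | quad i => simpa using quad i
    | comm i j h => simpa using comm i j h
    | braid i j h => simpa using braid i j h⟩

theorem heckeLift_T {n : ℕ} {B : Type} [Ring B] [Algebra ℂ B] (t : Fin (n - 1) → B)
    (quad : ∀ i, t i * t i = -t i)
    (comm : ∀ i j : Fin (n - 1), (i : ℕ) + 1 < j → t i * t j = t j * t i)
    (braid : ∀ i j : Fin (n - 1), (i : ℕ) + 1 = j → t i * t j * t i = t j * t i * t j)
    (i : Fin (n - 1)) : heckeLift t quad comm braid (T i) = t i := by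
  simp [heckeLift, T]

theorem hecke_induction {n : ℕ} {P : HeckeZero n → Prop}
    (halg : ∀ c : ℂ, P (algebraMap ℂ _ c)) (hT : ∀ i, P (T i))
    (hmul : ∀ a b, P a → P b → P (a * b)) (hadd : ∀ a b, P a → P b → P (a + b))
    (h : HeckeZero n) : P h := by
  obtain ⟨x, rfl⟩ := RingQuot.mkAlgHom_surjective ℂ (HeckeRel n) h
  induction x using FreeAlgebra.induction with
  | grade0 c => simpa using halg c
  | grade1 i => exact hT i
  | mul a b ha hb => simpa using hmul _ _ ha hb
  | add a b ha hb => simpa using hadd _ _ ha hb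

/-! ## The permutational right module on words -/

/-- Words `a_1 a_2 ⋯ a_n` of length `n`; the letter `a_{i+1}` is `w i`. -/
abbrev Word (n : ℕ) : Type := Fin n → ℕ

/-- The action of a 0-Hecke generator on a word, where `p`, `p'` are the two positions involved. -/
def tauWord {n : ℕ} (p p' : Fin n) (w : Word n) : Word n →₀ ℂ :=
  if w p < w p' then Finsupp.single (w ∘ Equiv.swap p p') 1
  else if w p = w p' then 0
  else -Finsupp.single w 1

/-- Linear extension of `tauWord`. -/
def tau {n : ℕ} (p p' : Fin n) : Module.End ℂ (Word n →₀ ℂ) :=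
  Finsupp.linearCombination ℂ (tauWord p p')

theorem tau_single {n : ℕ} (p p' : Fin n) (w : Word n) :
    tau p p' (Finsupp.single w 1) = tauWord p p' w := by
  simp [tau]

theorem tau_of_lt {n : ℕ} {p p' : Fin n} {w : Word n} (h : w p < w p') :
    tau p p' (Finsupp.single w 1) = Finsupp.single (w ∘ Equiv.swap p p') 1 := by
  simp [tau_single, tauWord, h]

theorem tau_of_eq {n : ℕ} {p p' : Fin n} {w : Word n} (h : w p = w p') :
    tau p p' (Finsupp.single w 1) = 0 := by
  simp [tau_single, tauWord, h]

theorem tau_of_gt {n : ℕ} {p p' : Fin n} {w : Word n} (h : w p' < w p) :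
    tau p p' (Finsupp.single w 1) = -Finsupp.single w 1 := by
  simp [tau_single, tauWord, h.not_gt, h.ne']

theorem end_ext {n : ℕ} {f g : Module.End ℂ (Word n →₀ ℂ)}
    (h : ∀ w, f (Finsupp.single w 1) = g (Finsupp.single w 1)) : f = g := by
  refine Finsupp.lhom_ext' fun w => LinearMap.ext_ring ?_
  simpa using h w

theorem tau_quad {n : ℕ} {p p' : Fin n} : tau p p' * tau p p' = -tau p p' := by
  refine end_ext fun w => ?_
  simp only [Module.End.mul_apply, LinearMap.neg_apply]
  rcases lt_trichotomy (w p) (w p') with h | h | h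
  · rw [tau_of_lt h, tau_of_gt (by simpa using h)]
  · simp [tau_of_eq h]
  · simp [tau_of_gt h]

theorem tau_comm {n : ℕ} {p p' s s' : Fin n} (h1 : p ≠ s) (h2 : p ≠ s') (h3 : p' ≠ s)
    (h4 : p' ≠ s') : tau p p' * tau s s' = tau s s' * tau p p' := by
  refine end_ext fun w => ?_
  have e1 : (w ∘ Equiv.swap p p') s = w s := by
    simp [Equiv.swap_apply_of_ne_of_ne h1.symm h3.symm]
  have e2 : (w ∘ Equiv.swap p p') s' = w s' := by
    simp [Equiv.swap_apply_of_ne_of_ne h2.symm h4.symm]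
  have e3 : (w ∘ Equiv.swap s s') p = w p := by
    simp [Equiv.swap_apply_of_ne_of_ne h1 h2]
  have e4 : (w ∘ Equiv.swap s s') p' = w p' := by
    simp [Equiv.swap_apply_of_ne_of_ne h3 h4]
  have e5 : (w ∘ Equiv.swap p p') ∘ Equiv.swap s s' = (w ∘ Equiv.swap s s') ∘ Equiv.swap p p' := by
    funext x
    simp only [Function.comp_apply, Equiv.swap_apply_def]
    split_ifs <;> simp_all
  simp only [Module.End.mul_apply]
  rcases lt_trichotomy (w p) (w p') with h | h | h <;>
  rcases lt_trichotomy (w s) (w s') with k | k | k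
  · rw [tau_of_lt h, tau_of_lt k, tau_of_lt (by rwa [e3, e4]), tau_of_lt (by rwa [e1, e2]), e5]
  · rw [tau_of_lt h, tau_of_eq k, tau_of_eq (by rwa [e1, e2]), map_zero]
  · rw [tau_of_lt h, tau_of_gt k, tau_of_gt (by rwa [e1, e2]), map_neg, tau_of_lt h]
  · rw [tau_of_eq h, tau_of_lt k, tau_of_eq (by rwa [e3, e4]), map_zero]
  · rw [tau_of_eq h, tau_of_eq k, map_zero, map_zero]
  · rw [tau_of_eq h, tau_of_gt k, map_neg, tau_of_eq h, map_zero, neg_zero]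
  · rw [tau_of_gt h, tau_of_lt k, map_neg, tau_of_lt k, tau_of_gt (by rwa [e3, e4])]
  · rw [tau_of_gt h, tau_of_eq k, map_neg, tau_of_eq k, map_zero, neg_zero]
  · rw [tau_of_gt h, tau_of_gt k, map_neg, map_neg, tau_of_gt h, tau_of_gt k]

set_option linter.unusedSimpArgs false in
theorem tau_braid {n : ℕ} {p p' s : Fin n} (h1 : p ≠ p') (h2 : p ≠ s) (h3 : p' ≠ s) :
    tau p p' * tau p' s * tau p p' = tau p' s * tau p p' * tau p' s := by
  refine end_ext fun w => ?_
  have e5 : ((w ∘ Equiv.swap p p') ∘ Equiv.swap p' s) ∘ Equiv.swap p p' =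
      ((w ∘ Equiv.swap p' s) ∘ Equiv.swap p p') ∘ Equiv.swap p' s := by
    funext x
    simp only [Function.comp_apply, Equiv.swap_apply_def]
    split_ifs <;> simp_all
  simp only [Module.End.mul_apply]
  rcases lt_trichotomy (w p) (w p') with a | a | a <;>
  rcases lt_trichotomy (w p') (w s) with b | b | b <;>
  rcases lt_trichotomy (w p) (w s) with c | c | c <;>
  first
  | (exfalso; omega)
  | simp [tau_single, tauWord, a, b, c, h1, h2, h2.symm, h3, h3.symm, h1.symm,
      a.not_gt, a.ne', b.not_gt, b.ne', c.not_gt, c.ne', Equiv.swap_apply_of_ne_of_ne, e5]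
  | simp [tau_single, tauWord, a, b, c, h1, h2, h2.symm, h3, h3.symm, h1.symm,
      b.not_gt, b.ne', c.not_gt, c.ne', Equiv.swap_apply_of_ne_of_ne, e5]
  | simp [tau_single, tauWord, a, b, c, h1, h2, h2.symm, h3, h3.symm, h1.symm,
      a.not_gt, a.ne', c.not_gt, c.ne', Equiv.swap_apply_of_ne_of_ne, e5]
  | simp [tau_single, tauWord, a, b, c, h1, h2, h2.symm, h3, h3.symm, h1.symm,
      a.not_gt, a.ne', b.not_gt, b.ne', Equiv.swap_apply_of_ne_of_ne, e5]
  | simp [tau_single, tauWord, a, b, c, h1, h2, h2.symm, h3, h3.symm, h1.symm,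
       Equiv.swap_apply_of_ne_of_ne, e5]

/-- The right representation of `H_n(0)` on `ℂ`-linear combinations of words, as an algebra
homomorphism `H_n(0)ᵐᵒᵖ → End_ℂ`; `T_{i+1}` acts on the letters in positions `i`, `i+1`
(positions counted from `0`). -/
def wordRep (n : ℕ) : (HeckeZero n)ᵐᵒᵖ →ₐ[ℂ] Module.End ℂ (Word n →₀ ℂ) :=
  AlgHom.opComm (heckeLift
    (fun i : Fin (n - 1) =>
      MulOpposite.op (tau (n := n) ⟨i, by omega⟩ ⟨i + 1, by omega⟩))
    (fun i => by
      rw [← MulOpposite.op_mul, tau_quad, MulOpposite.op_neg])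
    (fun i j h => by
      rw [← MulOpposite.op_mul, ← MulOpposite.op_mul, tau_comm] <;>
        simp only [ne_eq, Fin.mk.injEq] <;> omega)
    (fun i j h => by
      have hj : (⟨(i : ℕ) + 1, by omega⟩ : Fin n) = ⟨j, by omega⟩ := Fin.ext h
      rw [← MulOpposite.op_mul, ← MulOpposite.op_mul, ← MulOpposite.op_mul,
        ← MulOpposite.op_mul, ← mul_assoc, ← mul_assoc, hj, tau_braid] <;>
        simp only [ne_eq, Fin.mk.injEq] <;> omega))

/-- The right `H_n(0)`-module of `ℂ`-linear combinations of words of length `n`. -/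
instance wordModule (n : ℕ) : Module (HeckeZero n)ᵐᵒᵖ (Word n →₀ ℂ) :=
  Module.compHom (Word n →₀ ℂ) (wordRep n).toRingHom

theorem smul_word_def {n : ℕ} (h : (HeckeZero n)ᵐᵒᵖ) (m : Word n →₀ ℂ) :
    h • m = wordRep n h m := rfl

theorem op_T_smul {n : ℕ} (i : Fin (n - 1)) (m : Word n →₀ ℂ) :
    MulOpposite.op (T i) • m = tau ⟨i, by omega⟩ ⟨i + 1, by omega⟩ m := by
  have : wordRep n (MulOpposite.op (T i)) = tau ⟨i, by omega⟩ ⟨i + 1, by omega⟩ := by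
    simp [wordRep, AlgHom.opComm, heckeLift_T]
  rw [smul_word_def, this]

/-- The submodule of the module of words spanned by a set of words that is stable under
permutations of the positions. -/
def permutational {n : ℕ} (W : Set (Word n))
    (hW : ∀ w ∈ W, ∀ g : Equiv.Perm (Fin n), w ∘ g ∈ W) :
    Submodule (HeckeZero n)ᵐᵒᵖ (Word n →₀ ℂ) where
  carrier := {m | ∀ w ∈ m.support, w ∈ W}
  add_mem' := fun {a b} ha hb => (Finsupp.supported ℂ ℂ W).add_mem ha hb
  zero_mem' := (Finsupp.supported ℂ ℂ W).zero_mem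
  smul_mem' := by
    have tau_mem : ∀ (p p' : Fin n) (m : Word n →₀ ℂ), m ∈ Finsupp.supported ℂ ℂ W →
        tau p p' m ∈ Finsupp.supported ℂ ℂ W := by
      intro p p' m hm
      rw [tau, Finsupp.linearCombination_apply]
      refine Submodule.sum_mem _ fun w hw => Submodule.smul_mem _ _ ?_
      unfold tauWord
      split_ifs
      · exact Finsupp.single_mem_supported ℂ _ (hW w (hm hw) _)
      · exact Submodule.zero_mem _
      · exact Submodule.neg_mem _ (Finsupp.single_mem_supported ℂ _ (hm hw))
    have key : ∀ h : HeckeZero n, ∀ m ∈ Finsupp.supported ℂ ℂ W,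
        MulOpposite.op h • m ∈ Finsupp.supported ℂ ℂ W := by
      intro h
      induction h using hecke_induction with
      | halg c =>
        intro m hm
        have : MulOpposite.op (algebraMap ℂ (HeckeZero n) c) • m = c • m := by
          rw [smul_word_def, ← MulOpposite.algebraMap_apply, AlgHom.commutes,
            Module.algebraMap_end_apply]
        rw [this]
        exact Submodule.smul_mem _ _ hm
      | hT i => intro m hm; rw [op_T_smul]; exact tau_mem _ _ _ hm
      | hmul a b ha hb =>
        intro m hm
        rw [MulOpposite.op_mul, mul_smul]
        exact hb _ (ha _ hm)
      | hadd a b ha hb =>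
        intro m hm
        rw [MulOpposite.op_add, add_smul]
        exact Submodule.add_mem _ (ha _ hm) (hb _ hm)
    intro h m hm
    exact key h.unop m hm

/-! ## Parking functions -/

/-- A word with letters `≥ 1` whose nondecreasing rearrangement `a'_1 ⋯ a'_n` satisfies
`a'_i ≤ i` for all `i` (with positions counted from `0` in the code). The letters then lie
in `{1, …, n}`. -/
def IsParking {n : ℕ} (w : Word n) : Prop :=
  (∀ i, 1 ≤ w i) ∧ ∀ i : Fin n, (w ∘ Tuple.sort w) i ≤ (i : ℕ) + 1

/-- The statistic `‖w‖ = ∑ (a_i - 1)`. -/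
def wordNorm {n : ℕ} (w : Word n) : ℕ := ∑ i, (w i - 1)

/-- The homogeneous component of degree `d` of the permutational `H_n(0)`-module on parking
functions of length `n`: it is spanned by the parking functions with `‖w‖ = d`. -/
def parkingModule (n d : ℕ) : Submodule (HeckeZero n)ᵐᵒᵖ (Word n →₀ ℂ) :=
  permutational {w | IsParking w ∧ wordNorm w = d} (by
    rintro w ⟨⟨h1, h2⟩, h3⟩ g
    refine ⟨⟨fun i => h1 (g i), ?_⟩, ?_⟩
    · rw [Tuple.comp_perm_comp_sort_eq_comp_sort]
      exact h2
    · rw [← h3]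
      exact Equiv.sum_comp g (fun i => w i - 1))

/-! ## Noncommutative symmetric functions -/

/-- The algebra of noncommutative symmetric functions over `R`: the free associative algebra
on `S_1, S_2, …`; the generator with index `i` is `S_{i+1}`. -/
abbrev NSym (R : Type*) [CommRing R] : Type _ := FreeAlgebra R ℕ

/-- The noncommutative complete function `S_n`, with `S_0 = 1`. -/
def complete (R : Type*) [CommRing R] : ℕ → NSym R
  | 0 => 1
  | n + 1 => FreeAlgebra.ι R n

/-- `S^I = S_{i_1} ⋯ S_{i_r}` for a composition `I = (i_1, …, i_r)`. -/
def completeComp (R : Type*) [CommRing R] {n : ℕ} (I : Composition n) : NSym R :=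
  (I.blocks.map (complete R)).prod

/-- The ribbon function `R_I = ∑_J (-1)^{ℓ(I) - ℓ(J)} S^J`, the sum being over the compositions
`J` that are coarser than or equal to `I`. -/
def ribbon (R : Type*) [CommRing R] {n : ℕ} (I : Composition n) : NSym R :=
  ∑ J : Composition n with J.boundaries ⊆ I.boundaries,
    (-1 : R) ^ (I.length - J.length) • completeComp R J

/-! ## The noncommutative characteristic -/

/-- `i + 1` is a descent of the composition `I = (i_1, …, i_r)`, that is, one of the partial sums
`i_1`, `i_1 + i_2`, …, `i_1 + ⋯ + i_{r-1}`. -/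
def IsDescent {n : ℕ} (I : Composition n) (i : Fin (n - 1)) : Prop :=
  (⟨(i : ℕ) + 1, by omega⟩ : Fin (n + 1)) ∈ I.boundaries

instance {n : ℕ} (I : Composition n) (i : Fin (n - 1)) : Decidable (IsDescent I i) :=
  inferInstanceAs (Decidable (_ ∈ _))

/-- The character of `H_n(0)` with `T_i ↦ -1` if `i` is a descent of `I` and `T_i ↦ 0`
otherwise. -/
def simpleChar {n : ℕ} (I : Composition n) : HeckeZero n →ₐ[ℂ] ℂ :=
  heckeLift (fun i => if IsDescent I i then -1 else 0)
    (fun i => by split_ifs <;> simp)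
    (fun i j _ => mul_comm _ _)
    (fun i j _ => by split_ifs <;> simp)

/-- The one-dimensional simple right `H_n(0)`-module `C_I`, on which `H_n(0)` acts through the
character `simpleChar I`. -/
@[nolint unusedArguments]
def SimpleMod {n : ℕ} (_ : Composition n) : Type := ℂ

instance {n : ℕ} (I : Composition n) : AddCommGroup (SimpleMod I) :=
  inferInstanceAs (AddCommGroup ℂ)

instance {n : ℕ} (I : Composition n) : Module ℂ (SimpleMod I) :=
  inferInstanceAs (Module ℂ ℂ)

instance {n : ℕ} (I : Composition n) : Module (HeckeZero n)ᵐᵒᵖ (SimpleMod I) :=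
  Module.compHom ℂ ((simpleChar I).fromOpposite fun _ _ => mul_comm _ _).toRingHom

theorem smul_simple_def {n : ℕ} (I : Composition n) (h : (HeckeZero n)ᵐᵒᵖ) (z : SimpleMod I) :
    h • z = simpleChar I h.unop • z := rfl

instance {n : ℕ} (I : Composition n) : SMulCommClass (HeckeZero n)ᵐᵒᵖ ℂ (SimpleMod I) where
  smul_comm h c z := by rw [smul_simple_def, smul_simple_def, smul_comm]

/-- The multiplicity of the projective cover `P_I` of the simple module `C_I` in a finitely
generated projective right `H_n(0)`-module `M`, namely `dim Hom(M, C_I)`. -/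
def multiplicity {n : ℕ} (I : Composition n) (M : Type*) [AddCommGroup M]
    [Module (HeckeZero n)ᵐᵒᵖ M] : ℕ :=
  Module.finrank ℂ (M →ₗ[(HeckeZero n)ᵐᵒᵖ] SimpleMod I)

/-- The noncommutative characteristic of a finitely generated projective right `H_n(0)`-module:
the additive map sending the indecomposable projective module `P_I` to `R_I`. -/
def ncChar (R : Type*) [CommRing R] (n : ℕ) (M : Type*) [AddCommGroup M]
    [Module (HeckeZero n)ᵐᵒᵖ M] : NSym R :=
  ∑ I : Composition n, multiplicity I M • ribbon R I

/-- `G_n(q; A)`, the `q`-characteristic `∑_d q^d ch(M_d)` of the permutational module on parking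
functions of length `n`. All degrees occurring are at most `n * n`. -/
def parkingChar {R : Type*} [CommRing R] (q : R) (n : ℕ) : NSym R :=
  ∑ d ∈ Finset.range (n * n + 1), q ^ d • ncChar R n (parkingModule n d)

/-! ## Generating series; the variable of the power series is `x` (or `t`) -/

open PowerSeries

/-- The substitution `x ↦ c x` in a power series over `NSym R`. -/
def scaleVar {R : Type*} [CommRing R] (c : R) (f : PowerSeries (NSym R)) :
    PowerSeries (NSym R) :=
  PowerSeries.mk fun n => c ^ n • coeff n f

/-- `σ_t(A) = ∑ t^n S_n(A)`. -/
def sigma (R : Type*) [CommRing R] : PowerSeries (NSym R) :=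
  PowerSeries.mk (complete R)

/-- `σ_t([m]_q A)`, where `σ_t(cA) = σ_{ct}(A)`. For `m ≥ 0` it is
`σ_t(A) σ_t(qA) ⋯ σ_t(q^{m-1} A)`, and for `m = -k < 0` it is
`σ_t(q^{-1} A)⁻¹ σ_t(q^{-2} A)⁻¹ ⋯ σ_t(q^{-k} A)⁻¹`. -/
def sigmaBracket {R : Type*} [CommRing R] (q : Rˣ) : ℤ → PowerSeries (NSym R)
  | Int.ofNat m =>
      ((List.range m).map fun i => scaleVar ((q ^ i : Rˣ) : R) (sigma R)).prod
  | Int.negSucc k =>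
      ((List.range (k + 1)).map fun i =>
        Ring.inverse (scaleVar ((q⁻¹ ^ (i + 1) : Rˣ) : R) (sigma R))).prod

/-- `S_n([m]_q A)`, the coefficient of `t^n` in `σ_t([m]_q A)`. -/
def completeBracket {R : Type*} [CommRing R] (q : Rˣ) (n : ℕ) (m : ℤ) : NSym R :=
  coeff n (sigmaBracket q m)

/-- `F^{(r)}(x, q; A) = ∑ x^n q^{-n(n-1)/2} S_n([n+r]_q A)`. -/
def seriesF {R : Type*} [CommRing R] (q : Rˣ) (r : ℤ) : PowerSeries (NSym R) :=
  PowerSeries.mk fun n => ((q⁻¹ ^ n.choose 2 : Rˣ) : R) • completeBracket q n (n + r)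

/-- `G(x, q; A) = ∑ x^n q^{-n(n+1)/2} G_n(q; A)`. -/
def seriesG {R : Type*} [CommRing R] (q : Rˣ) : PowerSeries (NSym R) :=
  PowerSeries.mk fun n => ((q⁻¹ ^ (n + 1).choose 2 : Rˣ) : R) • parkingChar (q : R) n

end ParkingHecke

end

noncomputable section

namespace ParkingHecke

open MulOpposite

open Finset.HasAntidiagonal (antidiagonal mem_antidiagonal)

/-! The first half describes permutational modules. Every word arises from its nondecreasing
rearrangement u by the action of generators, and the only relations are those of the stabilizers,
u·T_i = 0 whenever u_i = u_{i+1} (`exists_wordHom`, `permutational_hom_ext`). An element e_u of the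
algebra with e_u T_i = 0 for these i and u·e_u = u therefore splits the canonical surjection from a
free module, which gives projectivity (`permutational_projective`). Homomorphisms to C_I have a
basis indexed by the nondecreasing words that increase strictly at the descents of I. Since S^K is
the sum of the R_I over the I coarser than or equal to K, the characteristic is the sum of S_{c_0}
S_{c_1} ⋯ over the contents c of the nondecreasing words (`ncChar_permutational`).

Thus G_n is the sum of q^{∑ i c_i} S_{c_0} ⋯ S_{c_{n-1}} over lists of sum n whose first k entries
add up to at least k, that is, over paths with steps c_i - 1 that stay nonnegative
(`parkingChar_eq_pathSum`). Without the positivity condition, the same weights on lists of length N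
+ 1 and sum N add up to S_N([N+1]_q A). These paths go from 0 to -1. Cutting them at the first visit
to -1 gives S_N([N+1]_q A) = ∑_{n+k=N} q^{(n+1)k} G_n S_k([k]_q A)
(`completeBracket_eq_sum_pathSum`), which is the case r = 1.

The other r follow from σ_t([m+1]_q A) = σ_t([m]_q A) σ_t(q^m A): the defect of the identity for r +
1 in degree N is the defect for r in degree N plus right multiples of defects of lower degree, so
all defects vanish by induction (`parkingDefect_eq_zero`). The normalizing powers of q turn the
convolution into a product of series. -/

/-! ## Words and adjacent transpositions -/

/-- The left one of the two positions on which the generator with index `i` acts. -/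
def posL {n : ℕ} (i : Fin (n - 1)) : Fin n := ⟨i, by omega⟩

/-- The right one of the two positions on which the generator with index `i` acts. -/
def posR {n : ℕ} (i : Fin (n - 1)) : Fin n := ⟨i + 1, by omega⟩

theorem posL_ne_posR {n : ℕ} (i : Fin (n - 1)) : posL i ≠ posR i := by
  simp [posL, posR]

/-- The word obtained by exchanging the letters in the positions `posL i`, `posR i`. -/
def swapAt {n : ℕ} (w : Word n) (i : Fin (n - 1)) : Word n := w ∘ Equiv.swap (posL i) (posR i)

@[simp] theorem swapAt_posL {n : ℕ} (w : Word n) (i : Fin (n - 1)) :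
    swapAt w i (posL i) = w (posR i) := by simp [swapAt]

@[simp] theorem swapAt_posR {n : ℕ} (w : Word n) (i : Fin (n - 1)) :
    swapAt w i (posR i) = w (posL i) := by simp [swapAt]

theorem swapAt_of_ne {n : ℕ} (w : Word n) (i : Fin (n - 1)) {p : Fin n} (h : p ≠ posL i)
    (h' : p ≠ posR i) : swapAt w i p = w p := by
  simp [swapAt, Equiv.swap_apply_of_ne_of_ne h h']

@[simp] theorem swapAt_swapAt {n : ℕ} (w : Word n) (i : Fin (n - 1)) :
    swapAt (swapAt w i) i = w := by
  funext p; simp [swapAt]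

theorem swapAt_comm {n : ℕ} (w : Word n) {i j : Fin (n - 1)} (h : (i : ℕ) + 1 < j) :
    swapAt (swapAt w i) j = swapAt (swapAt w j) i := by
  have h1 : posL i ≠ posL j := by simp only [posL, ne_eq, Fin.ext_iff]; omega
  have h2 : posL i ≠ posR j := by simp only [posL, posR, ne_eq, Fin.ext_iff]; omega
  have h3 : posR i ≠ posL j := by simp only [posL, posR, ne_eq, Fin.ext_iff]; omega
  have h4 : posR i ≠ posR j := by simp only [posR, ne_eq, Fin.ext_iff]; omega
  funext p
  simp only [swapAt, Function.comp_apply, Equiv.swap_apply_def]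
  generalize posL i = a at *
  generalize posR i = b at *
  generalize posL j = c at *
  generalize posR j = d at *
  split_ifs <;> simp_all

theorem posR_eq_posL {n : ℕ} {i j : Fin (n - 1)} (h : (i : ℕ) + 1 = j) : posR i = posL j :=
  Fin.ext h

theorem swapAt_braid {n : ℕ} (w : Word n) {i j : Fin (n - 1)} (h : (i : ℕ) + 1 = j) :
    swapAt (swapAt (swapAt w i) j) i = swapAt (swapAt (swapAt w j) i) j := by
  have h1 := posL_ne_posR i
  have h2 : posL i ≠ posR j := by simp only [posL, posR, ne_eq, Fin.ext_iff]; omega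
  have h3 := posL_ne_posR j
  funext p
  simp only [swapAt, Function.comp_apply, Equiv.swap_apply_def, posR_eq_posL h] at *
  generalize posL i = a at *
  generalize posL j = c at *
  generalize posR j = d at *
  split_ifs <;> simp_all

theorem monotone_iff_posL_le_posR {n : ℕ} (w : Word n) :
    Monotone w ↔ ∀ i, w (posL i) ≤ w (posR i) := by
  cases n with
  | zero => exact ⟨fun _ i => i.elim0, fun _ i => i.elim0⟩
  | succ n => exact Fin.monotone_iff_le_succ

/-- A statistic that decreases when a descent of a word is sorted. -/
def sortWeight {n : ℕ} (w : Word n) : ℕ := ∑ p : Fin n, (n - p) * w p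

/-- The coefficient `n - p` drops by one from `posL i` to `posR i`, so moving the smaller letter to
the left lowers the sum by the size of the descent. -/
theorem sortWeight_swapAt_lt {n : ℕ} {w : Word n} {i : Fin (n - 1)}
    (h : w (posR i) < w (posL i)) : sortWeight (swapAt w i) < sortWeight w := by
  have hm : posR i ∈ Finset.univ.erase (posL i) := by simp [(posL_ne_posR i).symm]
  unfold sortWeight
  rw [← Finset.add_sum_erase _ _ (Finset.mem_univ (posL i)), ← Finset.add_sum_erase _ _ hm,
    ← Finset.add_sum_erase Finset.univ (fun p : Fin n => (n - (p : ℕ)) * w p)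
      (Finset.mem_univ (posL i)),
    ← Finset.add_sum_erase _ (fun p : Fin n => (n - (p : ℕ)) * w p) hm,
    ← add_assoc, ← add_assoc, swapAt_posL, swapAt_posR]
  have e : ∑ p ∈ (Finset.univ.erase (posL i)).erase (posR i), (n - (p : ℕ)) * swapAt w i p =
      ∑ p ∈ (Finset.univ.erase (posL i)).erase (posR i), (n - (p : ℕ)) * w p := by
    refine Finset.sum_congr rfl fun p hp => ?_
    simp only [Finset.mem_erase, Finset.mem_univ, and_true] at hp
    rw [swapAt_of_ne w i hp.2 hp.1]
  rw [e]
  have h1 : n - ((posL i : Fin n) : ℕ) = (n - ((posR i : Fin n) : ℕ)) + 1 := by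
    simp only [posL, posR]; omega
  rw [h1]
  nlinarith

/-! ## Relations in the opposite of the 0-Hecke algebra -/

theorem T_quad {n : ℕ} (i : Fin (n - 1)) : (T i * T i : HeckeZero n) = -T i := by
  simpa [T] using RingQuot.mkAlgHom_rel ℂ (HeckeRel.quad i)

theorem T_comm {n : ℕ} {i j : Fin (n - 1)} (h : (i : ℕ) + 1 < j) :
    (T i * T j : HeckeZero n) = T j * T i := by
  simpa [T] using RingQuot.mkAlgHom_rel ℂ (HeckeRel.comm i j h)

theorem T_braid {n : ℕ} {i j : Fin (n - 1)} (h : (i : ℕ) + 1 = j) :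
    (T i * T j * T i : HeckeZero n) = T j * T i * T j := by
  simpa [T] using RingQuot.mkAlgHom_rel ℂ (HeckeRel.braid i j h)

/-! ### Equivariant extension from nondecreasing words to all words -/

section Spread

variable {n : ℕ} {N : Type*} [AddCommGroup N] [Module (HeckeZero n)ᵐᵒᵖ N]

theorem op_T_smul_smul_self (i : Fin (n - 1)) (x : N) :
    op (T i) • op (T i) • x = -(op (T i) • x) := by
  rw [smul_smul, ← op_mul, T_quad, op_neg, neg_smul]

theorem op_T_smul_comm {i j : Fin (n - 1)} (h : (i : ℕ) + 1 < j ∨ (j : ℕ) + 1 < i) (x : N) :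
    op (T i) • op (T j) • x = op (T j) • op (T i) • x := by
  rw [smul_smul, smul_smul, ← op_mul, ← op_mul]
  rcases h with h | h
  · rw [T_comm h]
  · rw [T_comm h]

theorem op_T_smul_braid {i j : Fin (n - 1)} (h : (i : ℕ) + 1 = j) (x : N) :
    op (T i) • op (T j) • op (T i) • x = op (T j) • op (T i) • op (T j) • x := by
  simp only [smul_smul, ← op_mul]
  rw [T_braid h]

open Classical in
/-- The extension to all words of a function on nondecreasing words that is equivariant for
the sorting of descents. -/
def spread (v : Word n → N) (w : Word n) : N :=
  if h : ∃ i, w (posR i) < w (posL i) then op (T h.choose) • spread v (swapAt w h.choose)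
  else v w
termination_by sortWeight w
decreasing_by exact sortWeight_swapAt_lt h.choose_spec

theorem spread_of_monotone (v : Word n → N) {w : Word n} (hw : Monotone w) :
    spread v w = v w := by
  rw [spread, dif_neg]
  rintro ⟨i, hi⟩
  exact absurd ((monotone_iff_posL_le_posR w).1 hw i) (not_le.2 hi)

/-- The diamond property of sorting. Distant descents are joined by the commutation relation.
Adjacent descents mean three strictly decreasing letters, and both ways of reversing them agree by
the braid relation. The hypothesis `ih` applies because every intermediate word has smaller weight.
-/
theorem op_T_smul_spread_confluent (v : Word n → N) (w : Word n)
    (ih : ∀ w', sortWeight w' < sortWeight w → ∀ i, w' (posR i) < w' (posL i) →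
      spread v w' = op (T i) • spread v (swapAt w' i)) {i j : Fin (n - 1)} (hij : i < j)
    (hi : w (posR i) < w (posL i)) (hj : w (posR j) < w (posL j)) :
    op (T i) • spread v (swapAt w i) = op (T j) • spread v (swapAt w j) := by
  have mi := sortWeight_swapAt_lt hi
  have mj := sortWeight_swapAt_lt hj
  have hij' : (i : ℕ) < j := hij
  rcases Nat.lt_or_ge ((i : ℕ) + 1) j with h | h
  · have ei : spread v (swapAt w i) = op (T j) • spread v (swapAt (swapAt w i) j) := by
      refine ih _ mi j ?_
      rwa [swapAt_of_ne, swapAt_of_ne] <;> simp only [posL, posR, ne_eq, Fin.ext_iff] <;> omega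
    have ej : spread v (swapAt w j) = op (T i) • spread v (swapAt (swapAt w j) i) := by
      refine ih _ mj i ?_
      rwa [swapAt_of_ne, swapAt_of_ne] <;> simp only [posL, posR, ne_eq, Fin.ext_iff] <;> omega
    rw [ei, ej, swapAt_comm w h, op_T_smul_comm (Or.inl h)]
  · have h : (i : ℕ) + 1 = j := by omega
    have hp := posR_eq_posL h
    have a1 : posR j ≠ posL i := by simp only [posL, posR, ne_eq, Fin.ext_iff]; omega
    have a2 : posR j ≠ posR i := by simp only [posR, ne_eq, Fin.ext_iff]; omega
    have a3 : posL i ≠ posL j := by simp only [posL, ne_eq, Fin.ext_iff]; omega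
    have b1 : swapAt w i (posR j) < swapAt w i (posL j) := by
      rw [← hp, swapAt_posR, swapAt_of_ne w i a1 a2]
      rw [hp] at hi; exact hj.trans hi
    have b2 : swapAt (swapAt w i) j (posR i) < swapAt (swapAt w i) j (posL i) := by
      rw [hp, swapAt_posL, swapAt_of_ne _ j a3 a1.symm, swapAt_posL, swapAt_of_ne w i a1 a2, hp]
      exact hj
    have c1 : swapAt w j (posR i) < swapAt w j (posL i) := by
      rw [hp, swapAt_posL, swapAt_of_ne w j a3 a1.symm]
      rw [hp] at hi; exact hj.trans hi
    have c2 : swapAt (swapAt w j) i (posR j) < swapAt (swapAt w j) i (posL j) := by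
      rw [← hp, swapAt_posR, swapAt_of_ne _ i a1 a2, swapAt_posR, swapAt_of_ne w j a3 a1.symm,
        ← hp]
      exact hi
    rw [ih _ mi j b1, ih _ ((sortWeight_swapAt_lt b1).trans mi) i b2, ih _ mj i c1,
      ih _ ((sortWeight_swapAt_lt c1).trans mj) j c2, swapAt_braid w h, op_T_smul_braid h]

/-- Confluence makes the descent chosen in the definition of `spread` irrelevant. -/
theorem spread_of_gt (v : Word n → N) (w : Word n) (i : Fin (n - 1))
    (hi : w (posR i) < w (posL i)) : spread v w = op (T i) • spread v (swapAt w i) := by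
  induction hm : sortWeight w using Nat.strong_induction_on generalizing w i with
  | _ m ih =>
    subst hm
    have ih' : ∀ w', sortWeight w' < sortWeight w → ∀ i, w' (posR i) < w' (posL i) →
      spread v w' = op (T i) • spread v (swapAt w' i) := fun w' h' i hi => ih _ h' w' i hi rfl
    have h : ∃ i, w (posR i) < w (posL i) := ⟨i, hi⟩
    rw [spread, dif_pos h]
    rcases lt_trichotomy h.choose i with hc | hc | hc
    · exact op_T_smul_spread_confluent v w ih' hc h.choose_spec hi
    · rw [hc]
    · exact (op_T_smul_spread_confluent v w ih' hc hi h.choose_spec).symm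

theorem op_T_smul_spread_of_lt (v : Word n → N) {w : Word n} {i : Fin (n - 1)}
    (hi : w (posL i) < w (posR i)) : op (T i) • spread v w = spread v (swapAt w i) := by
  rw [spread_of_gt v (swapAt w i) i (by simpa using hi), swapAt_swapAt]

theorem op_T_smul_spread_of_gt (v : Word n → N) {w : Word n} {i : Fin (n - 1)}
    (hi : w (posR i) < w (posL i)) : op (T i) • spread v w = -spread v w := by
  rw [spread_of_gt v w i hi, op_T_smul_smul_self]

/-- Induction on the sorting of `w`. A descent `j` far from `i` commutes with the equal pair. If `j`
is adjacent to `i`, sorting at `j` and then at `i` moves the equal pair to the positions of `j`, and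
the braid relation puts the generator of `j` innermost, where it acts by zero. -/
theorem op_T_smul_spread_of_eq {v : Word n → N}
    (hv : ∀ u, Monotone u → ∀ i, u (posL i) = u (posR i) → op (T i) • v u = 0)
    (w : Word n) (i : Fin (n - 1)) (hi : w (posL i) = w (posR i)) :
    op (T i) • spread v w = 0 := by
  induction hm : sortWeight w using Nat.strong_induction_on generalizing w i with
  | _ m ih =>
    subst hm
    by_cases h : Monotone w
    · rw [spread_of_monotone v h]; exact hv w h i hi
    · simp only [monotone_iff_posL_le_posR, not_forall, not_le] at h
      obtain ⟨j, hj⟩ := h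
      have mj := sortWeight_swapAt_lt hj
      have hne : (i : ℕ) ≠ j := by
        intro e; rw [Fin.ext e] at hi; omega
      rw [spread_of_gt v w j hj]
      rcases lt_trichotomy ((i : ℕ) + 1) j with h | h | h
      · rw [op_T_smul_comm (Or.inl h), ih _ mj _ i _ rfl, smul_zero]
        rwa [swapAt_of_ne, swapAt_of_ne] <;> simp only [posL, posR, ne_eq, Fin.ext_iff] <;> omega
      · have hp := posR_eq_posL h
        have a1 : posR j ≠ posL i := by simp only [posL, posR, ne_eq, Fin.ext_iff]; omega
        have a2 : posR j ≠ posR i := by simp only [posR, ne_eq, Fin.ext_iff]; omega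
        have a3 : posL i ≠ posL j := by simp only [posL, ne_eq, Fin.ext_iff]; omega
        have b : swapAt w j (posR i) < swapAt w j (posL i) := by
          rw [hp, swapAt_posL, swapAt_of_ne w j a3 a1.symm, hi, hp]; exact hj
        rw [spread_of_gt v _ i b, op_T_smul_braid h,
          ih _ ((sortWeight_swapAt_lt b).trans mj) _ j _ rfl, smul_zero, smul_zero]
        rw [← hp, swapAt_posR, swapAt_of_ne _ i a1 a2, swapAt_posR, swapAt_of_ne w j a3 a1.symm,
          ← hp, hi]
      · rcases Nat.lt_or_ge ((j : ℕ) + 1) i with h' | h'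
        · rw [op_T_smul_comm (Or.inr h'), ih _ mj _ i _ rfl, smul_zero]
          rwa [swapAt_of_ne, swapAt_of_ne] <;> simp only [posL, posR, ne_eq, Fin.ext_iff] <;> omega
        · have h : (j : ℕ) + 1 = i := by omega
          have hp := posR_eq_posL h
          have a1 : posR i ≠ posL j := by simp only [posL, posR, ne_eq, Fin.ext_iff]; omega
          have a2 : posR i ≠ posR j := by simp only [posR, ne_eq, Fin.ext_iff]; omega
          have a3 : posL j ≠ posL i := by simp only [posL, ne_eq, Fin.ext_iff]; omega
          have b : swapAt w j (posR i) < swapAt w j (posL i) := by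
            rw [← hp, swapAt_posR, swapAt_of_ne w j a1 a2, ← hi, ← hp]; exact hj
          rw [spread_of_gt v _ i b, ← op_T_smul_braid h,
            ih _ ((sortWeight_swapAt_lt b).trans mj) _ j _ rfl, smul_zero, smul_zero]
          rw [hp, swapAt_posL, swapAt_of_ne _ i a3 a1.symm, swapAt_posL, swapAt_of_ne w j a1 a2,
            hp, hi]

end Spread

/-! ## Homomorphisms out of permutational modules -/

section Hom

variable {n : ℕ} {N : Type*} [AddCommGroup N] [Module (HeckeZero n)ᵐᵒᵖ N]

theorem op_T_smul_single_of_lt {w : Word n} {i : Fin (n - 1)} (h : w (posL i) < w (posR i)) :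
    op (T i) • (Finsupp.single w 1 : Word n →₀ ℂ) = Finsupp.single (swapAt w i) 1 := by
  rw [op_T_smul]; exact tau_of_lt h

theorem op_T_smul_single_of_eq {w : Word n} {i : Fin (n - 1)} (h : w (posL i) = w (posR i)) :
    op (T i) • (Finsupp.single w 1 : Word n →₀ ℂ) = 0 := by
  rw [op_T_smul]; exact tau_of_eq h

theorem op_T_smul_single_of_gt {w : Word n} {i : Fin (n - 1)} (h : w (posR i) < w (posL i)) :
    op (T i) • (Finsupp.single w 1 : Word n →₀ ℂ) = -Finsupp.single w 1 := by
  rw [op_T_smul]; exact tau_of_gt h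

instance : IsScalarTower ℂ (HeckeZero n)ᵐᵒᵖ (Word n →₀ ℂ) where
  smul_assoc c h m := by
    rw [smul_word_def, smul_word_def, map_smul, LinearMap.smul_apply]

/-- A function on nondecreasing words whose values satisfy the relations of the stabilizers
extends to a homomorphism on the module of words. -/
theorem exists_wordHom [Module ℂ N] [IsScalarTower ℂ (HeckeZero n)ᵐᵒᵖ N] (v : Word n → N)
    (hv : ∀ u, Monotone u → ∀ i, u (posL i) = u (posR i) → op (T i) • v u = 0) :
    ∃ f : (Word n →₀ ℂ) →ₗ[(HeckeZero n)ᵐᵒᵖ] N, ∀ u, Monotone u → f (Finsupp.single u 1) = v u := by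
  have key : ∀ h : HeckeZero n, ∀ m : Word n →₀ ℂ,
      Finsupp.linearCombination ℂ (spread v) (op h • m) =
        op h • Finsupp.linearCombination ℂ (spread v) m := by
    intro h
    induction h using hecke_induction with
    | halg c =>
      intro m
      rw [← MulOpposite.algebraMap_apply, algebraMap_smul, algebraMap_smul, map_smul]
    | hT i =>
      intro m
      induction m using Finsupp.induction_linear with
      | zero => simp
      | add a b ha hb => simp only [smul_add, map_add, ha, hb]
      | single w c =>
        rw [← mul_one c, ← smul_eq_mul, ← Finsupp.smul_single, smul_comm,
          LinearMap.map_smul, LinearMap.map_smul, smul_comm (op (T i)) c]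
        congr 1
        rw [Finsupp.linearCombination_single, one_smul]
        rcases lt_trichotomy (w (posL i)) (w (posR i)) with h | h | h
        · rw [op_T_smul_single_of_lt h, Finsupp.linearCombination_single, one_smul,
            op_T_smul_spread_of_lt v h]
        · rw [op_T_smul_single_of_eq h, op_T_smul_spread_of_eq hv w i h, map_zero]
        · rw [op_T_smul_single_of_gt h, map_neg, Finsupp.linearCombination_single, one_smul,
            op_T_smul_spread_of_gt v h]
    | hmul a b ha hb => intro m; rw [op_mul, mul_smul, hb, ha, mul_smul]
    | hadd a b ha hb => intro m; rw [op_add, add_smul, map_add, ha, hb, add_smul]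
  have key' : ∀ (h : (HeckeZero n)ᵐᵒᵖ) (m : Word n →₀ ℂ),
      Finsupp.linearCombination ℂ (spread v) (h • m) =
        h • Finsupp.linearCombination ℂ (spread v) m := fun h => key h.unop
  refine ⟨{ toFun := Finsupp.linearCombination ℂ (spread v)
            map_add' := map_add _
            map_smul' := key' }, fun u hu => ?_⟩
  change Finsupp.linearCombination ℂ (spread v) (Finsupp.single u 1) = v u
  rw [Finsupp.linearCombination_single, one_smul, spread_of_monotone v hu]

variable {W : Set (Word n)} {hW : ∀ w ∈ W, ∀ g : Equiv.Perm (Fin n), w ∘ g ∈ W}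

theorem single_mem_permutational {w : Word n} (hw : w ∈ W) :
    (Finsupp.single w 1 : Word n →₀ ℂ) ∈ permutational W hW :=
  Finsupp.single_mem_supported ℂ (1 : ℂ) hw

/-- A word in `W`, as an element of the permutational module on `W`. -/
def ofWord (hW : ∀ w ∈ W, ∀ g : Equiv.Perm (Fin n), w ∘ g ∈ W) (w : Word n) (hw : w ∈ W) :
    permutational W hW := ⟨Finsupp.single w 1, single_mem_permutational hw⟩

theorem swapAt_mem (hW : ∀ w ∈ W, ∀ g : Equiv.Perm (Fin n), w ∘ g ∈ W) {w : Word n} (hw : w ∈ W)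
    (i : Fin (n - 1)) : swapAt w i ∈ W := hW w hw _

/-- A homomorphism on a permutational module is determined by the nondecreasing words. -/
theorem permutational_hom_ext {f g : permutational W hW →ₗ[(HeckeZero n)ᵐᵒᵖ] N}
    (h : ∀ u (hu : u ∈ W), Monotone u → f (ofWord hW u hu) = g (ofWord hW u hu)) : f = g := by
  have key : ∀ m, ∀ w (hw : w ∈ W), sortWeight w = m →
      f (ofWord hW w hw) = g (ofWord hW w hw) := by
    intro m
    induction m using Nat.strong_induction_on with
    | _ m ih =>
      rintro w hw rfl
      by_cases hm : Monotone w
      · exact h w hw hm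
      · simp only [monotone_iff_posL_le_posR, not_forall, not_le] at hm
        obtain ⟨i, hi⟩ := hm
        have e : ofWord hW w hw = op (T i) • ofWord hW (swapAt w i) (swapAt_mem hW hw i) := by
          refine Subtype.ext ?_
          change Finsupp.single w 1 = op (T i) • (Finsupp.single (swapAt w i) 1 : Word n →₀ ℂ)
          rw [op_T_smul_single_of_lt (by simpa using hi), swapAt_swapAt]
        rw [e, map_smul, map_smul, ih _ (sortWeight_swapAt_lt hi) _ _ rfl]
  refine LinearMap.ext fun m => ?_
  -- Coefficients enter through `algebraMap`, since `f` and `g` are only known to be linear over the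
  -- Hecke algebra.
  have e : m = ∑ w ∈ m.1.support.attach, algebraMap ℂ (HeckeZero n)ᵐᵒᵖ (m.1 w) •
      ofWord hW w.1 (m.2 w.1 w.2) := by
    refine Subtype.ext ?_
    rw [AddSubmonoidClass.coe_finsetSum]
    have : ∀ w : m.1.support, ((algebraMap ℂ (HeckeZero n)ᵐᵒᵖ (m.1 w) •
        ofWord hW w.1 (m.2 w.1 w.2) : permutational W hW) : Word n →₀ ℂ) =
        Finsupp.single w.1 (m.1 w) := by
      intro w
      change algebraMap ℂ (HeckeZero n)ᵐᵒᵖ (m.1 w) • (Finsupp.single w.1 1 : Word n →₀ ℂ) = _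
      rw [algebraMap_smul, Finsupp.smul_single, smul_eq_mul, mul_one]
    simp only [this]
    rw [Finset.sum_attach m.1.support (fun w => Finsupp.single w (m.1 w))]
    exact (Finsupp.sum_single m.1).symm
  rw [e, map_sum, map_sum]
  exact Finset.sum_congr rfl fun w _ => by rw [map_smul, map_smul, key _ _ _ rfl]

end Hom

/-! ## Projectivity -/

section Projective

variable {n : ℕ}

/-- The word of a permutation, with letters `0, …, n - 1`. -/
def permWord (g : Equiv.Perm (Fin n)) : Word n := fun p => (g p : ℕ)

theorem swapAt_permWord (g : Equiv.Perm (Fin n)) (i : Fin (n - 1)) :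
    swapAt (permWord g) i = permWord (g * Equiv.swap (posL i) (posR i)) := rfl

theorem permWord_posL_ne_posR (g : Equiv.Perm (Fin n)) (i : Fin (n - 1)) :
    permWord g (posL i) ≠ permWord g (posR i) := fun h =>
  posL_ne_posR i (g.injective (Fin.ext h))

theorem eq_one_of_monotone_permWord {g : Equiv.Perm (Fin n)} (h : Monotone (permWord g)) :
    g = 1 := by
  have hg : StrictMono g := fun a b hab =>
    lt_of_le_of_ne (h hab.le) fun e => hab.ne (g.injective e)
  refine Equiv.ext fun p => ?_
  have := Subsingleton.elim (hg.orderIsoOfSurjective g g.surjective) (OrderIso.refl (Fin n))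
  exact congrFun (congrArg DFunLike.coe this) p

open Classical in
/-- The sum of the words of the permutations in the stabilizer of a word. -/
def stabSum (u : Word n) : Word n →₀ ℂ :=
  ∑ g ∈ Finset.univ.filter (fun g : Equiv.Perm (Fin n) => u ∘ g = u), Finsupp.single (permWord g) 1

theorem comp_swap_eq {u : Word n} {i : Fin (n - 1)} (hi : u (posL i) = u (posR i)) :
    u ∘ Equiv.swap (posL i) (posR i) = u := by
  funext p
  simp only [Function.comp_apply, Equiv.swap_apply_def]
  split_ifs with h1 h2
  · rw [h1, hi]
  · rw [h2, hi]
  · rfl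

/-- Right multiplication by the transposition of `posL i` and `posR i` preserves the stabilizer and
pairs its elements. In each pair the generator sends the word with an ascent to its partner and the
partner to its own negative. -/
theorem op_T_smul_stabSum {u : Word n} {i : Fin (n - 1)} (hi : u (posL i) = u (posR i)) :
    op (T i) • stabSum u = 0 := by
  have lt_case : ∀ g : Equiv.Perm (Fin n), permWord g (posL i) < permWord g (posR i) →
      op (T i) • (Finsupp.single (permWord g) 1 : Word n →₀ ℂ) +
        op (T i) • (Finsupp.single (permWord (g * Equiv.swap (posL i) (posR i))) 1) = 0 := by
    intro g hg
    rw [op_T_smul_single_of_lt hg, ← swapAt_permWord, op_T_smul_single_of_gt (by simpa using hg),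
      add_neg_cancel]
  unfold stabSum
  rw [Finset.smul_sum]
  refine Finset.sum_involution (fun g _ => g * Equiv.swap (posL i) (posR i)) ?_ ?_ ?_ ?_
  · intro g _
    rcases lt_or_gt_of_ne (permWord_posL_ne_posR g i) with h | h
    · exact lt_case g h
    · have := lt_case (g * Equiv.swap (posL i) (posR i)) (by
        rw [← swapAt_permWord]; simpa using h)
      rw [mul_assoc, Equiv.swap_mul_self, mul_one] at this
      rw [add_comm]; exact this
  · intro g _ _ h
    have := mul_eq_left.1 h
    exact posL_ne_posR i (Equiv.swap_eq_one_iff.1 this)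
  · intro g hg
    simp only [Finset.mem_filter, Finset.mem_univ, true_and] at hg ⊢
    rw [Equiv.Perm.coe_mul, ← Function.comp_assoc, hg, comp_swap_eq hi]
  · intro g _
    rw [mul_assoc, Equiv.swap_mul_self, mul_one]

/-- The idempotent of the stabilizer of a nondecreasing word. -/
theorem exists_stabilizer_idempotent {u : Word n} (hu : Monotone u) :
    ∃ e : (HeckeZero n)ᵐᵒᵖ, (∀ i, u (posL i) = u (posR i) → op (T i) * e = 0) ∧
      e • (Finsupp.single u 1 : Word n →₀ ℂ) = Finsupp.single u 1 := by
  classical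
  -- Words of permutations have distinct letters, so no stabilizer condition arises and the word of
  -- the identity may be sent to `1` in the regular module.
  obtain ⟨φ, hφ⟩ := exists_wordHom (n := n) (N := (HeckeZero n)ᵐᵒᵖ)
    (fun w => if w = permWord 1 then 1 else 0) (by
      intro w _ i hi
      rw [if_neg, smul_zero]
      rintro rfl
      exact permWord_posL_ne_posR 1 i hi)
  have hone : φ (Finsupp.single (permWord 1) 1) = 1 := by
    have hm : Monotone (permWord (1 : Equiv.Perm (Fin n))) := fun a b h => h
    rw [hφ _ hm, if_pos rfl]
  -- Only the identity contributes to the action of `φ (stabSum u)` on `u`: for any other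
  -- stabilizing `g`, sorting the word of `g` by its descents ends with a generator that acts on an
  -- equal pair of `u`.
  have hvanish : ∀ m, ∀ g : Equiv.Perm (Fin n), sortWeight (permWord g) = m → u ∘ g = u →
      g ≠ 1 → φ (Finsupp.single (permWord g) 1) • (Finsupp.single u 1 : Word n →₀ ℂ) = 0 := by
    intro m
    induction m using Nat.strong_induction_on with
    | _ m ih =>
      rintro g rfl hg hne
      have hmon : ¬ Monotone (permWord g) := fun h => hne (eq_one_of_monotone_permWord h)
      simp only [monotone_iff_posL_le_posR, not_forall, not_le] at hmon
      obtain ⟨i, hi⟩ := hmon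
      -- Since `g` preserves the blocks of equal letters of the nondecreasing `u`, its descents lie
      -- inside blocks.
      have hui : u (posL i) = u (posR i) := by
        refine le_antisymm (hu (by simp [posL, posR])) ?_
        have h1 : u (g (posR i)) = u (posR i) := congrFun hg _
        have h2 : u (g (posL i)) = u (posL i) := congrFun hg _
        rw [← h1, ← h2]
        exact hu hi.le
      have e : (Finsupp.single (permWord g) 1 : Word n →₀ ℂ) =
          op (T i) • Finsupp.single (permWord (g * Equiv.swap (posL i) (posR i))) 1 := by
        rw [← swapAt_permWord, op_T_smul_single_of_lt (by simpa using hi), swapAt_swapAt]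
      rw [e, map_smul, smul_eq_mul, mul_smul]
      by_cases h1 : g * Equiv.swap (posL i) (posR i) = 1
      · rw [h1, hone, one_smul, op_T_smul_single_of_eq hui]
      · rw [ih _ _ _ rfl _ h1, smul_zero]
        · rw [← swapAt_permWord]; exact sortWeight_swapAt_lt hi
        · rw [Equiv.Perm.coe_mul, ← Function.comp_assoc, hg, comp_swap_eq hui]
  refine ⟨φ (stabSum u), fun i hi => ?_, ?_⟩
  · rw [← smul_eq_mul, ← map_smul, op_T_smul_stabSum hi, map_zero]
  · unfold stabSum
    rw [map_sum, Finset.sum_smul, Finset.sum_eq_single 1]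
    · rw [hone, one_smul]
    · intro g hg hne
      exact hvanish _ g rfl (by simpa using hg) hne
    · intro h; exact absurd (by simp) h

/-- Sending each nondecreasing word `u` of `W` to `e u` times its own basis vector respects the
stabilizer relations, and `e u • u = u` makes this a section of the canonical map from the free
module on the elements of the module. -/
theorem permutational_projective (W : Set (Word n))
    (hW : ∀ w ∈ W, ∀ g : Equiv.Perm (Fin n), w ∘ g ∈ W) :
    Module.Projective (HeckeZero n)ᵐᵒᵖ (permutational W hW) := by
  classical
  choose e he heu using fun (u : Word n) (hu : Monotone u) => exists_stabilizer_idempotent hu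
  obtain ⟨f, hf⟩ := exists_wordHom (n := n) (N := permutational W hW →₀ (HeckeZero n)ᵐᵒᵖ)
    (fun u => if h : Monotone u ∧ u ∈ W then Finsupp.single (ofWord hW u h.2) (e u h.1) else 0) (by
      intro u hu i hi
      split_ifs with h
      · rw [Finsupp.smul_single, smul_eq_mul, he u hu i hi, Finsupp.single_zero]
      · rw [smul_zero])
  refine ⟨f ∘ₗ (permutational W hW).subtype, ?_⟩
  have key : Finsupp.linearCombination (HeckeZero n)ᵐᵒᵖ (id : permutational W hW →
        permutational W hW) ∘ₗ
      (f ∘ₗ (permutational W hW).subtype) = LinearMap.id := by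
    refine permutational_hom_ext (N := permutational W hW) fun u hu hm => ?_
    rw [LinearMap.comp_apply, LinearMap.comp_apply, LinearMap.id_apply]
    change Finsupp.linearCombination (HeckeZero n)ᵐᵒᵖ id (f (Finsupp.single u 1)) = _
    rw [hf u hm, dif_pos ⟨hm, hu⟩, Finsupp.linearCombination_single, id_eq]
    exact Subtype.ext (heu u hm)
  exact fun m => LinearMap.congr_fun key m

end Projective

/-! ## Multiplicities -/

section Multiplicity

variable {n : ℕ}

instance (I : Composition n) : IsScalarTower ℂ (HeckeZero n)ᵐᵒᵖ (SimpleMod I) where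
  smul_assoc c h z := by
    rw [smul_simple_def, smul_simple_def, unop_smul, map_smul, smul_assoc]

theorem op_T_smul_simple (I : Composition n) (i : Fin (n - 1)) (z : SimpleMod I) :
    op (T i) • z = if IsDescent I i then -z else 0 := by
  rw [smul_simple_def, unop_op, simpleChar, heckeLift_T]
  split_ifs <;> simp

/-- The words in `W` that index a basis of the space of homomorphisms from the permutational
module on `W` to `C_I`. -/
def sortedWordsOver (W : Set (Word n)) (I : Composition n) : Set (Word n) :=
  {u | u ∈ W ∧ Monotone u ∧ ∀ i, IsDescent I i → u (posL i) < u (posR i)}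

/-- A homomorphism is a free choice of values on nondecreasing words, subject to the relations at
equal pairs. On `C_I` such a relation is void where `T_i` acts by `0` and forces the value `0` where
it acts by `-1`. -/
theorem multiplicity_permutational {W : Set (Word n)} (hfin : W.Finite)
    (hW : ∀ w ∈ W, ∀ g : Equiv.Perm (Fin n), w ∘ g ∈ W) (I : Composition n) :
    multiplicity I (permutational W hW) = (sortedWordsOver W I).ncard := by
  classical
  let S := sortedWordsOver W I
  have : Fintype S := (hfin.subset fun u hu => hu.1).fintype
  let E : (permutational W hW →ₗ[(HeckeZero n)ᵐᵒᵖ] SimpleMod I) →ₗ[ℂ] (S → SimpleMod I) :=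
    { toFun := fun f u => f (ofWord hW u.1 u.2.1)
      map_add' := fun _ _ => rfl
      map_smul' := fun _ _ => rfl }
  have vanish : ∀ f : permutational W hW →ₗ[(HeckeZero n)ᵐᵒᵖ] SimpleMod I, ∀ u (hu : u ∈ W),
      Monotone u → u ∉ S → f (ofWord hW u hu) = 0 := by
    intro f u hu hm hS
    have : ∃ i, IsDescent I i ∧ u (posR i) ≤ u (posL i) := by
      by_contra! h
      exact hS ⟨hu, hm, h⟩
    obtain ⟨i, hI, hi⟩ := this
    have hi' : u (posL i) = u (posR i) := le_antisymm (hm (by simp [posL, posR])) hi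
    have h0 : op (T i) • ofWord hW u hu = 0 := Subtype.ext (op_T_smul_single_of_eq hi')
    have h1 := op_T_smul_simple I i (f (ofWord hW u hu))
    rw [← map_smul, h0, map_zero, if_pos hI] at h1
    exact neg_eq_zero.1 h1.symm
  have hE : Function.Bijective E := by
    constructor
    · intro f g hfg
      refine permutational_hom_ext fun u hu hm => ?_
      by_cases hS : u ∈ S
      · exact congrFun hfg ⟨u, hS⟩
      · rw [vanish f u hu hm hS, vanish g u hu hm hS]
    · intro c
      obtain ⟨f, hf⟩ := exists_wordHom (N := SimpleMod I)
        (fun u => if h : u ∈ S then c ⟨u, h⟩ else 0) (by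
          intro u _ i hi
          split_ifs with h
          · rw [op_T_smul_simple, if_neg]
            exact fun hI => absurd (h.2.2 i hI) (by omega)
          · rw [smul_zero])
      refine ⟨f ∘ₗ (permutational W hW).subtype, funext fun u => ?_⟩
      change f (Finsupp.single u.1 1) = c u
      rw [hf u.1 u.2.2.1, dif_pos u.2]
  have h1 := (LinearEquiv.ofBijective E hE).finrank_eq
  unfold multiplicity
  rw [h1, ← Nat.card_coe_set_eq, Nat.card_eq_fintype_card]
  exact Module.finrank_fintype_fun_eq_card ℂ

end Multiplicity

/-! ## Inversion of the definition of the ribbon functions -/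

theorem boundaries_injective {n : ℕ} :
    Function.Injective (Composition.boundaries : Composition n → Finset (Fin (n + 1))) := by
  intro I J h
  refine (compositionEquiv n).injective (CompositionAsSet.ext ?_)
  exact h

theorem zero_mem_boundaries {n : ℕ} (I : Composition n) : (0 : Fin (n + 1)) ∈ I.boundaries :=
  I.toCompositionAsSet.zero_mem

theorem last_mem_boundaries {n : ℕ} (I : Composition n) : Fin.last n ∈ I.boundaries :=
  I.toCompositionAsSet.getLast_mem

/-- The compositions between `J` and `K` correspond to the subsets of the boundaries of `K` that are
missing in `J`, and the alternating sum over the subsets of a nonempty set is zero. -/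
theorem sum_interval_sign {n : ℕ} {R : Type*} [CommRing R] {J K : Composition n}
    (h : J.boundaries ⊆ K.boundaries) :
    ∑ I : Composition n with J.boundaries ⊆ I.boundaries ∧ I.boundaries ⊆ K.boundaries,
      (-1 : R) ^ (I.length - J.length) = if J = K then 1 else 0 := by
  have h1 : ∑ I : Composition n with J.boundaries ⊆ I.boundaries ∧ I.boundaries ⊆ K.boundaries,
      (-1 : R) ^ (I.length - J.length) =
      ∑ s ∈ (K.boundaries \ J.boundaries).powerset, (-1 : R) ^ s.card := by
    refine Finset.sum_bij' (fun I _ => I.boundaries \ J.boundaries)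
      (fun s _ => (CompositionAsSet.mk (s ∪ J.boundaries)
        (Finset.mem_union_right _ (zero_mem_boundaries J))
        (Finset.mem_union_right _ (last_mem_boundaries J))).toComposition) ?_ ?_ ?_ ?_ ?_
    · intro I hI
      simp only [Finset.mem_filter, Finset.mem_univ, true_and] at hI
      exact Finset.mem_powerset.2 (Finset.sdiff_subset_sdiff hI.2 subset_rfl)
    · intro s hs
      rw [Finset.mem_powerset] at hs
      simp only [Finset.mem_filter, Finset.mem_univ, true_and,
        CompositionAsSet.toComposition_boundaries]
      exact ⟨Finset.subset_union_right,
        Finset.union_subset (hs.trans Finset.sdiff_subset) h⟩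
    · intro I hI
      simp only [Finset.mem_filter, Finset.mem_univ, true_and] at hI
      apply boundaries_injective
      rw [CompositionAsSet.toComposition_boundaries]
      exact Finset.sdiff_union_of_subset hI.1
    · intro s hs
      rw [Finset.mem_powerset] at hs
      rw [CompositionAsSet.toComposition_boundaries]
      exact Finset.union_sdiff_cancel_right (Finset.disjoint_of_subset_left hs
        Finset.sdiff_disjoint)
    · intro I hI
      simp only [Finset.mem_filter, Finset.mem_univ, true_and] at hI
      rw [Finset.card_sdiff_of_subset hI.1, I.card_boundaries_eq_succ_length,
        J.card_boundaries_eq_succ_length, Nat.add_sub_add_right]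
  have h2 := congrArg (Int.cast : ℤ → R)
    (Finset.sum_powerset_neg_one_pow_card (x := K.boundaries \ J.boundaries))
  push_cast at h2
  rw [h1, h2]
  congr 1
  rw [Finset.sdiff_eq_empty_iff_subset, eq_iff_iff]
  exact ⟨fun h' => boundaries_injective (h.antisymm h'), fun h' => h' ▸ subset_rfl⟩

/-- `S^K` is the sum of the ribbon functions of the compositions coarser than or equal to `K`. -/
theorem sum_ribbon {n : ℕ} (R : Type*) [CommRing R] (K : Composition n) :
    ∑ I : Composition n with I.boundaries ⊆ K.boundaries, ribbon R I = completeComp R K := by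
  unfold ribbon
  rw [Finset.sum_comm' (t' := Finset.univ.filter
      (fun J : Composition n => J.boundaries ⊆ K.boundaries))
    (s' := fun J => Finset.univ.filter
      (fun I : Composition n => J.boundaries ⊆ I.boundaries ∧ I.boundaries ⊆ K.boundaries))]
  · rw [Finset.sum_congr rfl (g := fun J => if J = K then completeComp R J else 0)]
    · rw [Finset.sum_ite_eq', if_pos (by simp)]
    · intro J hJ
      rw [← Finset.sum_smul, sum_interval_sign (by simpa using hJ), ite_smul, one_smul, zero_smul]
  · intro I J
    simp only [Finset.mem_filter, Finset.mem_univ, true_and]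
    exact ⟨fun h => ⟨⟨h.2, h.1⟩, h.2.trans h.1⟩, fun h => ⟨h.1.2, h.1.1⟩⟩

/-- Descents are the boundaries other than `0` and `n`, which belong to every composition. -/
theorem boundaries_subset_iff {n : ℕ} (I K : Composition n) :
    I.boundaries ⊆ K.boundaries ↔ ∀ i, IsDescent I i → IsDescent K i := by
  refine ⟨fun h i hi => h hi, fun h j hj => ?_⟩
  by_cases h0 : j = 0
  · exact h0 ▸ zero_mem_boundaries K
  by_cases hn : j = Fin.last n
  · exact hn ▸ last_mem_boundaries K
  have h0' : (j : ℕ) ≠ 0 := fun e => h0 (Fin.ext e)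
  have hn' : (j : ℕ) ≠ n := fun e => hn (Fin.ext e)
  have e : (⟨(j : ℕ) - 1 + 1, by omega⟩ : Fin (n + 1)) = j := Fin.ext (by simp only; omega)
  have := h ⟨(j : ℕ) - 1, by omega⟩
  simp only [IsDescent, e] at this
  exact this hj

/-! ## The characteristic of a permutational module -/

open Classical in
/-- If every nondecreasing word `u` of `W` has a composition with descents the ascents of `u`, the
characteristic of the permutational module on `W` is the sum of the corresponding `S^K`. -/
theorem ncChar_permutational {R : Type*} [CommRing R] {n : ℕ} {W : Set (Word n)} (hfin : W.Finite)
    (hW : ∀ w ∈ W, ∀ g : Equiv.Perm (Fin n), w ∘ g ∈ W) (F : Word n → NSym R)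
    (hF : ∀ u ∈ W, Monotone u → ∃ K : Composition n,
      (∀ i, IsDescent K i ↔ u (posL i) < u (posR i)) ∧ completeComp R K = F u) :
    ncChar R n (permutational W hW) = ∑ u ∈ hfin.toFinset with Monotone u, F u := by
  unfold ncChar
  have h1 : ∀ I : Composition n, multiplicity I (permutational W hW) • ribbon R I =
      ∑ u ∈ hfin.toFinset with Monotone u,
        if ∀ i, IsDescent I i → u (posL i) < u (posR i) then ribbon R I else 0 := by
    intro I
    rw [multiplicity_permutational hfin, ← Finset.sum_filter, Finset.sum_const,
      ← Set.ncard_coe_finset]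
    congr 2
    ext u
    simp [sortedWordsOver, and_assoc]
  simp only [h1]
  rw [Finset.sum_comm]
  refine Finset.sum_congr rfl fun u hu => ?_
  simp only [Finset.mem_filter, Set.Finite.mem_toFinset] at hu
  obtain ⟨K, hK, hKF⟩ := hF u hu.1 hu.2
  rw [← hKF, ← sum_ribbon, ← Finset.sum_filter]
  refine Finset.sum_congr (Finset.filter_congr fun I _ => ?_) fun _ _ => rfl
  rw [boundaries_subset_iff]
  simp only [hK]

/-! ## Compositions and contents of nondecreasing words -/

/-- Lets contents with zero entries stand for compositions: a zero entry only repeats a partial sum.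
-/
theorem exists_sum_take_filter (c : List ℕ) (j : ℕ) :
    (∃ k, ((c.filter (0 < ·)).take k).sum = j) ↔ ∃ k, (c.take k).sum = j := by
  induction c generalizing j with
  | nil => simp
  | cons a c ih =>
    rcases Nat.eq_zero_or_pos a with rfl | ha
    · rw [List.filter_cons_of_neg (by simp), ih]
      constructor
      · rintro ⟨k, hk⟩
        exact ⟨k + 1, by simpa using hk⟩
      · rintro ⟨k, hk⟩
        cases k with
        | zero => exact ⟨0, by simpa using hk⟩
        | succ k => exact ⟨k, by simpa using hk⟩
    · rw [List.filter_cons_of_pos (by simpa using ha)]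
      constructor
      · rintro ⟨k, hk⟩
        cases k with
        | zero => exact ⟨0, by simpa using hk⟩
        | succ k =>
          rw [List.take_succ_cons, List.sum_cons] at hk
          obtain ⟨k', hk'⟩ := (ih (j - a)).1 ⟨k, by omega⟩
          exact ⟨k' + 1, by rw [List.take_succ_cons, List.sum_cons]; omega⟩
      · rintro ⟨k, hk⟩
        cases k with
        | zero => exact ⟨0, by simpa using hk⟩
        | succ k =>
          rw [List.take_succ_cons, List.sum_cons] at hk
          obtain ⟨k', hk'⟩ := (ih (j - a)).2 ⟨k, by omega⟩
          exact ⟨k' + 1, by rw [List.take_succ_cons, List.sum_cons]; omega⟩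

theorem mem_boundaries_iff {n : ℕ} (K : Composition n) (j : Fin (n + 1)) :
    j ∈ K.boundaries ↔ ∃ k, (K.blocks.take k).sum = j := by
  simp only [Composition.boundaries, Finset.mem_map, Finset.mem_univ, true_and]
  constructor
  · rintro ⟨k, rfl⟩
    exact ⟨k, rfl⟩
  · rintro ⟨k, hk⟩
    refine ⟨⟨min k K.length, by omega⟩, Fin.ext ?_⟩
    change (K.blocks.take (min k K.length)).sum = j
    rw [← hk]
    rcases le_total k K.length with h | h
    · rw [min_eq_left h]
    · rw [min_eq_right h, List.take_of_length_le (l := K.blocks) (i := k) (by simpa using h),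
        List.take_of_length_le (by simp)]

/-- The composition obtained by deleting the zeros of a list. -/
def compOfList (c : List ℕ) {n : ℕ} (h : c.sum = n) : Composition n where
  blocks := c.filter (0 < ·)
  blocks_pos := fun hi => by simpa using (List.mem_filter.1 hi).2
  blocks_sum := by
    rw [← h]
    clear h
    induction c with
    | nil => rfl
    | cons a c ih =>
      rcases Nat.eq_zero_or_pos a with rfl | ha
      · rw [List.filter_cons_of_neg (by simp), ih]; simp
      · rw [List.filter_cons_of_pos (by simpa using ha), List.sum_cons, ih, List.sum_cons]

theorem completeComp_compOfList (R : Type*) [CommRing R] (c : List ℕ) {n : ℕ} (h : c.sum = n) :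
    completeComp R (compOfList c h) = (c.map (complete R)).prod := by
  change ((c.filter (0 < ·)).map (complete R)).prod = _
  clear h
  induction c with
  | nil => rfl
  | cons a c ih =>
    rcases Nat.eq_zero_or_pos a with rfl | ha
    · rw [List.filter_cons_of_neg (by simp), ih]; simp [complete]
    · rw [List.filter_cons_of_pos (by simpa using ha), List.map_cons, List.prod_cons, ih,
        List.map_cons, List.prod_cons]

/-- The numbers of occurrences of the letters `o, …, o + m - 1` in a word. -/
def contentList {n : ℕ} (w : Word n) (o m : ℕ) : List ℕ :=
  (List.range' o m).map fun v => (Finset.univ.filter fun p => w p = v).card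

theorem contentList_succ {n : ℕ} (w : Word n) (o m : ℕ) : contentList w o (m + 1) =
    (Finset.univ.filter fun p => w p = o).card :: contentList w (o + 1) m := by
  simp [contentList, List.range'_succ]

@[simp] theorem length_contentList {n : ℕ} (w : Word n) (o m : ℕ) :
    (contentList w o m).length = m := by simp [contentList]

theorem sum_contentList {n : ℕ} (w : Word n) (o m : ℕ) :
    (contentList w o m).sum = (Finset.univ.filter fun p => o ≤ w p ∧ w p < o + m).card := by
  induction m generalizing o with
  | zero =>
    symm
    simp only [contentList, List.range'_zero, List.map_nil, List.sum_nil, Finset.card_eq_zero]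
    exact Finset.filter_eq_empty_iff.2 fun p _ => by omega
  | succ m ih =>
    rw [contentList_succ, List.sum_cons, ih, ← Finset.card_union_of_disjoint]
    · congr 1
      ext p
      simp only [Finset.mem_union, Finset.mem_filter, Finset.mem_univ, true_and]
      omega
    · rw [Finset.disjoint_filter]
      intro p _ h
      omega

theorem take_contentList {n : ℕ} (w : Word n) (o m k : ℕ) :
    (contentList w o m).take k = contentList w o (min k m) := by
  induction m generalizing o k with
  | zero => simp [contentList]
  | succ m ih =>
    cases k with
    | zero => simp [contentList]
    | succ k => rw [contentList_succ, List.take_succ_cons, ih, Nat.succ_min_succ, contentList_succ]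

theorem sum_take_contentList {n m : ℕ} {w : Word n} (h1 : ∀ p, 1 ≤ w p) (h2 : ∀ p, w p ≤ m)
    (k : ℕ) : ((contentList w 1 m).take k).sum = (Finset.univ.filter fun p => w p ≤ k).card := by
  rw [take_contentList, sum_contentList]
  congr 1
  ext p
  have := h1 p
  have := h2 p
  simp only [Finset.mem_filter, Finset.mem_univ, true_and]
  omega

theorem sum_contentList_eq {n m : ℕ} {w : Word n} (h1 : ∀ p, 1 ≤ w p) (h2 : ∀ p, w p ≤ m) :
    (contentList w 1 m).sum = n := by
  rw [sum_contentList, Finset.filter_true_of_mem, Finset.card_univ, Fintype.card_fin]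
  intro p _
  have := h1 p
  have := h2 p
  omega

/-- The letters at most `k` of a nondecreasing word occupy an initial segment of positions. -/
theorem letter_le_iff {n : ℕ} {w : Word n} (hw : Monotone w) (p : Fin n) (k : ℕ) :
    w p ≤ k ↔ (p : ℕ) < (Finset.univ.filter fun p => w p ≤ k).card := by
  constructor
  · intro h
    have : (Finset.Iic p).card ≤ (Finset.univ.filter fun p => w p ≤ k).card :=
      Finset.card_le_card fun r hr => by simpa using (hw (Finset.mem_Iic.1 hr)).trans h
    rwa [Fin.card_Iic] at this
  · intro h
    by_contra! hp
    have : (Finset.univ.filter fun p => w p ≤ k).card ≤ (Finset.Iio p).card :=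
      Finset.card_le_card fun r hr => by
        simp only [Finset.mem_filter, Finset.mem_univ, true_and] at hr
        rw [Finset.mem_Iio]
        by_contra! hr'
        exact absurd (hw hr') (by omega)
    rw [Fin.card_Iio] at this
    omega

/-- The counts of letters at most `k` are the partial sums of the content; such a count ends between
two positions exactly when the word increases there. -/
theorem card_letters_le_eq_iff {n : ℕ} {w : Word n} (hw : Monotone w) (i : Fin (n - 1)) :
    (∃ k, (Finset.univ.filter fun p => w p ≤ k).card = (i : ℕ) + 1) ↔
      w (posL i) < w (posR i) := by
  have hL : ((posL i : Fin n) : ℕ) = i := rfl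
  have hR : ((posR i : Fin n) : ℕ) = i + 1 := rfl
  constructor
  · rintro ⟨k, hk⟩
    have h1 := letter_le_iff hw (posL i) k
    have h2 := letter_le_iff hw (posR i) k
    omega
  · intro h
    have h1 := letter_le_iff hw (posL i) (w (posL i))
    have h2 := letter_le_iff hw (posR i) (w (posL i))
    exact ⟨w (posL i), by omega⟩

theorem exists_composition_of_monotone (R : Type*) [CommRing R] {n m : ℕ} {w : Word n}
    (hw : Monotone w) (h1 : ∀ p, 1 ≤ w p) (h2 : ∀ p, w p ≤ m) :
    ∃ K : Composition n, (∀ i, IsDescent K i ↔ w (posL i) < w (posR i)) ∧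
      completeComp R K = ((contentList w 1 m).map (complete R)).prod := by
  refine ⟨compOfList _ (sum_contentList_eq h1 h2), fun i => ?_, completeComp_compOfList R _ _⟩
  rw [IsDescent, mem_boundaries_iff, ← card_letters_le_eq_iff hw]
  change (∃ k, (((contentList w 1 m).filter (0 < ·)).take k).sum = (i : ℕ) + 1) ↔ _
  rw [exists_sum_take_filter]
  simp only [sum_take_contentList h1 h2]

/-! ## The characteristic of the parking functions -/

theorem IsParking.le {n : ℕ} {w : Word n} (h : IsParking w) (p : Fin n) : w p ≤ n := by
  have := h.2 ((Tuple.sort w).symm p)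
  simp only [Function.comp_apply, Equiv.apply_symm_apply] at this
  omega

theorem isParking_iff_of_monotone {n : ℕ} {w : Word n} (hw : Monotone w) :
    IsParking w ↔ (∀ p, 1 ≤ w p) ∧ ∀ p : Fin n, w p ≤ (p : ℕ) + 1 := by
  rw [IsParking, (Tuple.sort_eq_refl_iff_monotone).2 hw]
  rfl

theorem finite_isParking (n : ℕ) : {w : Word n | IsParking w}.Finite :=
  (Set.finite_Iic (fun _ => n : Word n)).subset fun _ h p => IsParking.le h p

open Classical in
/-- The nondecreasing parking functions of length `n`. -/
def sortedParking (n : ℕ) : Finset (Word n) :=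
  (finite_isParking n).toFinset.filter fun w => Monotone w

theorem mem_sortedParking {n : ℕ} {w : Word n} :
    w ∈ sortedParking n ↔ IsParking w ∧ Monotone w := by
  simp [sortedParking]

theorem parkingChar_eq {R : Type*} [CommRing R] (q : R) (n : ℕ) :
    parkingChar q n = ∑ w ∈ sortedParking n,
      q ^ wordNorm w • ((contentList w 1 n).map (complete R)).prod := by
  classical
  have hd : ∀ d, ncChar R n (parkingModule n d) = ∑ w ∈ sortedParking n with wordNorm w = d,
      ((contentList w 1 n).map (complete R)).prod := by
    intro d
    have hfin : {w : Word n | IsParking w ∧ wordNorm w = d}.Finite :=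
      (finite_isParking n).subset fun w h => h.1
    unfold parkingModule
    rw [ncChar_permutational hfin _ (fun w => ((contentList w 1 n).map (complete R)).prod)
      fun w hw hm => exists_composition_of_monotone R hm hw.1.1 (IsParking.le hw.1)]
    refine Finset.sum_congr ?_ fun _ _ => rfl
    ext w
    simp only [Finset.mem_filter, Set.Finite.mem_toFinset, Set.mem_ofPred_eq, mem_sortedParking]
    tauto
  -- The cut-off of the degrees in `parkingChar` loses nothing.
  have hle : ∀ w ∈ sortedParking n, wordNorm w ∈ Finset.range (n * n + 1) := by
    intro w hw
    rw [Finset.mem_range, Nat.lt_succ_iff]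
    calc wordNorm w ≤ ∑ _p : Fin n, n := Finset.sum_le_sum fun p _ =>
          (Nat.sub_le _ _).trans ((mem_sortedParking.1 hw).1.le p)
      _ = n * n := by simp
  unfold parkingChar
  rw [← Finset.sum_fiberwise_of_maps_to hle]
  refine Finset.sum_congr rfl fun d _ => ?_
  rw [hd, Finset.smul_sum]
  refine Finset.sum_congr rfl fun w hw => ?_
  rw [(Finset.mem_filter.1 hw).2]

/-! ## Contents of parking functions as lattice paths -/

/-- The sums over the lists of length `m` with sum `M` whose partial sums, increased by `h`, stay
above the diagonal, weighted as `listWeight`. -/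
def pathSum {R : Type*} [CommRing R] (q : R) : ℕ → ℕ → ℕ → NSym R
  | 0, M, _ => if M = 0 then 1 else 0
  | _ + 1, 0, 0 => 0
  | m + 1, M + 1, 0 => ∑ a ∈ antidiagonal M,
      q ^ a.2 • (complete R (a.1 + 1) * pathSum q m a.2 a.1)
  | m + 1, M, h + 1 => ∑ a ∈ antidiagonal M,
      q ^ a.2 • (complete R a.1 * pathSum q m a.2 (h + a.1))

/-- The lists of length `m` with sum `M` whose partial sums, increased by `h`, stay above the
diagonal. -/
def pathLists : ℕ → ℕ → ℕ → Finset (List ℕ)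
  | 0, M, _ => if M = 0 then {[]} else ∅
  | _ + 1, 0, 0 => ∅
  | m + 1, M + 1, 0 => (antidiagonal M).biUnion fun a =>
      (pathLists m a.2 a.1).image (List.cons (a.1 + 1))
  | m + 1, M, h + 1 => (antidiagonal M).biUnion fun a =>
      (pathLists m a.2 (h + a.1)).image (List.cons a.1)

theorem mem_pathLists {m M h : ℕ} {c : List ℕ} : c ∈ pathLists m M h ↔
    c.length = m ∧ c.sum = M ∧ ∀ k ≤ m, k ≤ h + (c.take k).sum := by
  induction m generalizing M h c with
  | zero =>
    rw [pathLists]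
    split_ifs with hM
    · rw [Finset.mem_singleton]
      constructor
      · rintro rfl
        simp [hM]
      · rintro ⟨h1, -⟩
        exact List.length_eq_zero_iff.1 h1
    · simp only [Finset.notMem_empty, false_iff]
      rintro ⟨h1, h2, -⟩
      rw [List.length_eq_zero_iff.1 h1] at h2
      exact hM h2.symm
  | succ m ih =>
    cases c with
    | nil =>
      refine iff_of_false (fun hc => ?_) (by simp)
      match M, h, hc with
      | 0, 0, hc => simp [pathLists] at hc
      | M + 1, 0, hc => simp [pathLists] at hc
      | M, h + 1, hc => simp [pathLists] at hc
    | cons x c =>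
      have hcond : (∀ k ≤ m + 1, k ≤ h + ((x :: c).take k).sum) ↔
          ∀ k ≤ m, k + 1 ≤ h + x + (c.take k).sum := by
        constructor
        · intro H k hk
          have := H (k + 1) (by omega)
          rw [List.take_succ_cons, List.sum_cons] at this
          omega
        · intro H k hk
          cases k with
          | zero => omega
          | succ k =>
            have := H k (by omega)
            rw [List.take_succ_cons, List.sum_cons]
            omega
      rw [hcond, List.length_cons, List.sum_cons]
      match M, h with
      | 0, 0 =>
        simp only [pathLists, Finset.notMem_empty, false_iff]
        rintro ⟨-, h2, h3⟩
        have := h3 0 (by omega)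
        simp at this
        omega
      | M + 1, 0 =>
        simp only [pathLists, Finset.mem_biUnion, mem_antidiagonal, Finset.mem_image, ih,
          List.cons.injEq]
        constructor
        · rintro ⟨a, ha, c', ⟨h1, h2, h3⟩, rfl, rfl⟩
          exact ⟨by omega, by omega, fun k hk => by have := h3 k hk; omega⟩
        · rintro ⟨h1, h2, h3⟩
          -- At height `0` the first entry must be positive, which justifies the witness `x - 1`.
          have h0 := h3 0 (by omega)
          simp only [List.take_zero, List.sum_nil] at h0
          exact ⟨(x - 1, c.sum), by simp only; omega, c,
            ⟨by omega, rfl, fun k hk => by have := h3 k hk; simp only; omega⟩,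
            by simp only; omega, rfl⟩
      | M, h + 1 =>
        simp only [pathLists, Finset.mem_biUnion, mem_antidiagonal, Finset.mem_image, ih,
          List.cons.injEq]
        constructor
        · rintro ⟨a, ha, c', ⟨h1, h2, h3⟩, rfl, rfl⟩
          exact ⟨by omega, by omega, fun k hk => by have := h3 k hk; omega⟩
        · rintro ⟨h1, h2, h3⟩
          exact ⟨(x, c.sum), by simp only; omega, c,
            ⟨by omega, rfl, fun k hk => by have := h3 k hk; simp only; omega⟩, rfl, rfl⟩

/-- The weight `q^{∑ i c_i} S_{c_0} S_{c_1} ⋯` of a list `c_0, c_1, …`. -/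
def listWeight {R : Type*} [CommRing R] (q : R) : List ℕ → NSym R
  | [] => 1
  | a :: c => q ^ c.sum • (complete R a * listWeight q c)

theorem sum_biUnion_cons {A : Type*} [AddCommMonoid A] (M : ℕ) (g : ℕ → ℕ)
    (hg : Function.Injective g) (L : ℕ × ℕ → Finset (List ℕ)) (f : List ℕ → A) :
    ∑ c ∈ (antidiagonal M).biUnion (fun a => (L a).image (List.cons (g a.1))), f c =
      ∑ a ∈ antidiagonal M, ∑ c ∈ L a, f (g a.1 :: c) := by
  rw [Finset.sum_biUnion]
  · refine Finset.sum_congr rfl fun a _ => ?_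
    rw [Finset.sum_image]
    intro c _ c' _ hc
    exact (List.cons.inj hc).2
  · intro a ha b hb hab
    rw [Function.onFun, Finset.disjoint_left]
    intro c hc hc'
    obtain ⟨d, -, rfl⟩ := Finset.mem_image.1 hc
    obtain ⟨d', -, hd⟩ := Finset.mem_image.1 hc'
    have h1 := hg (List.cons.inj hd).1
    have ha' := mem_antidiagonal.1 ha
    have hb' := mem_antidiagonal.1 hb
    exact hab (Prod.ext h1.symm (by omega))

theorem pathSum_eq {R : Type*} [CommRing R] (q : R) (m M h : ℕ) :
    pathSum q m M h = ∑ c ∈ pathLists m M h, listWeight q c := by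
  induction m generalizing M h with
  | zero =>
    rw [pathSum, pathLists]
    split_ifs <;> simp [listWeight]
  | succ m ih =>
    have aux : ∀ (x b h : ℕ), q ^ b • (complete R x * pathSum q m b h) =
        ∑ c ∈ pathLists m b h, listWeight q (x :: c) := by
      intro x b h
      rw [ih, Finset.mul_sum, Finset.smul_sum]
      refine Finset.sum_congr rfl fun c hc => ?_
      rw [listWeight, (mem_pathLists.1 hc).2.1]
    match M, h with
    | 0, 0 => simp [pathSum, pathLists]
    | M + 1, 0 =>
      rw [pathSum, pathLists, sum_biUnion_cons M (· + 1) (add_left_injective 1)]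
      exact Finset.sum_congr rfl fun a _ => aux _ _ _
    | M, h + 1 =>
      rw [pathSum, pathLists]
      refine (Finset.sum_congr rfl fun a _ => aux _ _ _).trans (sum_biUnion_cons M id
        Function.injective_id (fun a => pathLists m a.2 (h + a.1)) (listWeight q)).symm

/-- Each step of the recursion raises the offset `o` by one and multiplies by `q` once for every
letter still above it, so a letter contributes its distance to `o`. For `o = 1` the exponent is
`wordNorm`. -/
theorem listWeight_contentList {R : Type*} [CommRing R] (q : R) {n : ℕ} (w : Word n) (o m : ℕ) :
    listWeight q (contentList w o m) =
      q ^ (∑ p with o ≤ w p ∧ w p < o + m, (w p - o)) •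
        ((contentList w o m).map (complete R)).prod := by
  induction m generalizing o with
  | zero =>
    rw [Finset.filter_false_of_mem (by intro p _; omega)]
    simp [contentList, listWeight]
  | succ m ih =>
    rw [contentList_succ, listWeight, ih, List.map_cons, List.prod_cons, mul_smul_comm, smul_smul,
      ← pow_add, sum_contentList, Finset.card_eq_sum_ones, ← Finset.sum_add_distrib]
    congr 2
    rw [Finset.sum_filter, Finset.sum_filter]
    refine Finset.sum_congr rfl fun p _ => ?_
    split_ifs <;> omega

theorem list_eq_of_sum_take_eq {c d : List ℕ} (hl : c.length = d.length)
    (h : ∀ k ≤ c.length, (c.take k).sum = (d.take k).sum) : c = d := by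
  induction c generalizing d with
  | nil => exact (List.length_eq_zero_iff.1 hl.symm).symm
  | cons a c ih =>
    cases d with
    | nil => simp at hl
    | cons b d =>
      have h1 : a = b := by simpa using h 1 (by simp)
      subst h1
      congr 1
      refine ih (by simpa using hl) fun k hk => ?_
      simpa using h (k + 1) (by simpa using hk)

theorem sum_take_mono (c : List ℕ) : Monotone fun k => (c.take k).sum := by
  intro k l hkl
  change (c.take k).sum ≤ (c.take l).sum
  obtain ⟨r, rfl⟩ := Nat.exists_eq_add_of_le hkl
  rw [List.take_add, List.sum_append]
  omega

/-- The nondecreasing word with content `c`. -/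
def wordOfContent (n : ℕ) (c : List ℕ) : Word n := fun p =>
  ((Finset.range n).filter fun v => (c.take (v + 1)).sum ≤ p).card + 1

/-- Partial sums increase, so the `v` counted in the definition form an initial segment, and `k`
bounds the letter exactly when the sum of the first `k` entries exceeds `p`. -/
theorem wordOfContent_le_iff {n : ℕ} (c : List ℕ) (p : Fin n) {k : ℕ} (hk : k ≤ n) :
    wordOfContent n c p ≤ k ↔ (p : ℕ) < (c.take k).sum := by
  unfold wordOfContent
  constructor
  · intro h
    by_contra! h'
    have : (Finset.range k).card ≤
        ((Finset.range n).filter fun v => (c.take (v + 1)).sum ≤ p).card :=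
      Finset.card_le_card fun v hv => by
        rw [Finset.mem_range] at hv
        rw [Finset.mem_filter, Finset.mem_range]
        exact ⟨by omega, (sum_take_mono c (by omega : v + 1 ≤ k)).trans h'⟩
    rw [Finset.card_range] at this
    omega
  · intro h
    have hk0 : k ≠ 0 := by rintro rfl; simp at h
    have : ((Finset.range n).filter fun v => (c.take (v + 1)).sum ≤ p).card ≤
        (Finset.range (k - 1)).card :=
      Finset.card_le_card fun v hv => by
        rw [Finset.mem_filter, Finset.mem_range] at hv
        rw [Finset.mem_range]
        by_contra! hv'
        have h2 : (c.take k).sum ≤ (c.take (v + 1)).sum :=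
          sum_take_mono c (by omega : k ≤ v + 1)
        omega
    rw [Finset.card_range] at this
    omega

theorem monotone_wordOfContent (n : ℕ) (c : List ℕ) : Monotone (wordOfContent n c) := by
  intro p r hpr
  refine Nat.succ_le_succ (Finset.card_le_card fun v hv => ?_)
  rw [Finset.mem_filter] at hv ⊢
  exact ⟨hv.1, hv.2.trans hpr⟩

theorem sum_take_le_sum (c : List ℕ) (k : ℕ) : (c.take k).sum ≤ c.sum := by
  conv_rhs => rw [← List.take_append_drop k c, List.sum_append]
  omega

/-- A nondecreasing word is determined by its content, and its parking condition says that at least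
`k` letters are at most `k`, which is the path condition on partial sums. -/
theorem parkingChar_eq_pathSum {R : Type*} [CommRing R] (q : R) (n : ℕ) :
    parkingChar q n = pathSum q n n 0 := by
  rw [parkingChar_eq, pathSum_eq]
  refine Finset.sum_bij (fun w _ => contentList w 1 n) ?_ ?_ ?_ ?_
  · intro w hw
    obtain ⟨hp, hm⟩ := mem_sortedParking.1 hw
    refine mem_pathLists.2 ⟨length_contentList _ _ _, sum_contentList_eq hp.1 hp.le,
      fun k hk => ?_⟩
    rw [sum_take_contentList hp.1 hp.le, zero_add]
    cases k with
    | zero => omega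
    | succ k =>
      exact (letter_le_iff hm ⟨k, hk⟩ (k + 1)).1 (((isParking_iff_of_monotone hm).1 hp).2 ⟨k, hk⟩)
  · intro w hw w' hw' h
    obtain ⟨hp, hm⟩ := mem_sortedParking.1 hw
    obtain ⟨hp', hm'⟩ := mem_sortedParking.1 hw'
    have key : ∀ p k, w p ≤ k ↔ w' p ≤ k := by
      intro p k
      rw [letter_le_iff hm, letter_le_iff hm', ← sum_take_contentList hp.1 hp.le,
        ← sum_take_contentList hp'.1 hp'.le, h]
    exact funext fun p => le_antisymm ((key p _).2 le_rfl) ((key p _).1 le_rfl)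
  · intro c hc
    obtain ⟨hl, hs, hk⟩ := mem_pathLists.1 hc
    have h1 : ∀ p, 1 ≤ wordOfContent n c p := fun p => Nat.le_add_left _ _
    have h2 : ∀ p, wordOfContent n c p ≤ n := fun p => by
      rw [wordOfContent_le_iff c p le_rfl, List.take_of_length_le hl.le, hs]
      exact p.2
    have hm := monotone_wordOfContent n c
    refine ⟨wordOfContent n c, mem_sortedParking.2
      ⟨(isParking_iff_of_monotone hm).2 ⟨h1, fun p => ?_⟩, hm⟩, ?_⟩
    · rw [wordOfContent_le_iff c p p.2]
      simpa using hk ((p : ℕ) + 1) p.2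
    · refine list_eq_of_sum_take_eq (by rw [length_contentList, hl]) fun k hk' => ?_
      rw [length_contentList] at hk'
      rw [sum_take_contentList h1 h2]
      simp only [wordOfContent_le_iff c _ hk']
      rw [Fin.card_filter_val_lt]
      exact min_eq_right (by rw [← hs]; exact sum_take_le_sum c k)
  · intro w hw
    obtain ⟨hp, hm⟩ := mem_sortedParking.1 hw
    rw [listWeight_contentList, Finset.filter_true_of_mem]
    · rfl
    · intro p _
      have := hp.1 p
      have := hp.le p
      omega

/-! ## Generating series -/

open PowerSeries

section Series

variable {R : Type*} [CommRing R]

@[simp] theorem coeff_scaleVar (c : R) (f : PowerSeries (NSym R)) (n : ℕ) :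
    coeff n (scaleVar c f) = c ^ n • coeff n f := coeff_mk _ _

theorem scaleVar_mul (c : R) (f g : PowerSeries (NSym R)) :
    scaleVar c (f * g) = scaleVar c f * scaleVar c g := by
  ext n
  rw [coeff_scaleVar, coeff_mul, coeff_mul, Finset.smul_sum]
  refine Finset.sum_congr rfl fun p hp => ?_
  rw [coeff_scaleVar, coeff_scaleVar, smul_mul_smul_comm, ← pow_add, mem_antidiagonal.1 hp]

theorem scaleVar_scaleVar (c d : R) (f : PowerSeries (NSym R)) :
    scaleVar c (scaleVar d f) = scaleVar (c * d) f := by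
  ext n
  rw [coeff_scaleVar, coeff_scaleVar, coeff_scaleVar, smul_smul, mul_pow]

theorem scaleVar_one_right (c : R) : scaleVar c 1 = 1 := by
  ext n
  rw [coeff_scaleVar, coeff_one]
  split_ifs with h
  · rw [h, pow_zero, one_smul]
  · rw [smul_zero]

theorem isUnit_of_coeff_zero {A : Type*} [Ring A] {f : PowerSeries A} (h : coeff 0 f = 1) :
    IsUnit f := by
  have h' : constantCoeff f = ((1 : Aˣ) : A) := by
    rw [← coeff_zero_eq_constantCoeff_apply, h, Units.val_one]
  exact ⟨⟨f, invOfUnit f 1, mul_invOfUnit f 1 h', invOfUnit_mul f 1 h'⟩, rfl⟩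

@[simp] theorem coeff_sigma (n : ℕ) : coeff n (sigma R) = complete R n := coeff_mk _ _

theorem isUnit_scaleVar_sigma (c : R) : IsUnit (scaleVar c (sigma R)) :=
  isUnit_of_coeff_zero (by rw [coeff_scaleVar, pow_zero, one_smul, coeff_sigma, complete])

/-! ### The series of the multiples [m]_q A and their recursions -/

theorem sigmaBracket_zero (q : Rˣ) : sigmaBracket q 0 = 1 := rfl

/-- Holds uniformly in the sign of `m`: for `m < 0` the new factor cancels the last inverse. This
right-hand recursion serves to change `r`. -/
theorem sigmaBracket_add_one (q : Rˣ) (m : ℤ) :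
    sigmaBracket q (m + 1) = sigmaBracket q m * scaleVar ((q ^ m : Rˣ) : R) (sigma R) := by
  cases m with
  | ofNat m =>
    change ((List.range (m + 1)).map fun i => scaleVar ((q ^ i : Rˣ) : R) (sigma R)).prod =
      ((List.range m).map fun i => scaleVar ((q ^ i : Rˣ) : R) (sigma R)).prod * _
    rw [List.range_succ, List.map_append, List.prod_append, List.map_singleton,
      List.prod_singleton, Int.ofNat_eq_natCast, zpow_natCast]
  | negSucc k =>
    have hu := isUnit_scaleVar_sigma (R := R) ((q⁻¹ ^ (k + 1) : Rˣ) : R)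
    have h1 : sigmaBracket q (Int.negSucc k) = ((List.range k).map fun i =>
        Ring.inverse (scaleVar ((q⁻¹ ^ (i + 1) : Rˣ) : R) (sigma R))).prod *
        Ring.inverse (scaleVar ((q⁻¹ ^ (k + 1) : Rˣ) : R) (sigma R)) := by
      rw [sigmaBracket, List.range_succ, List.map_append, List.prod_append, List.map_singleton,
        List.prod_singleton]
    have h2 : sigmaBracket q (Int.negSucc k + 1) = ((List.range k).map fun i =>
        Ring.inverse (scaleVar ((q⁻¹ ^ (i + 1) : Rˣ) : R) (sigma R))).prod := by
      cases k with
      | zero => rfl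
      | succ k => rfl
    rw [h1, h2, zpow_negSucc, ← inv_pow, mul_assoc, Ring.inverse_mul_cancel _ hu, mul_one]

/-- Splits off the leftmost factor instead of the rightmost one. This is the form needed for paths,
which are read from their first step. -/
theorem sigmaBracket_natCast_succ (q : Rˣ) (m : ℕ) :
    sigmaBracket q ((m + 1 : ℕ) : ℤ) = sigma R * scaleVar (q : R) (sigmaBracket q m) := by
  induction m with
  | zero =>
    have h : scaleVar ((q ^ (0 : ℤ) : Rˣ) : R) (sigma R) = sigma R := by
      ext n
      rw [coeff_scaleVar, zpow_zero, Units.val_one, one_pow, one_smul]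
    rw [Nat.cast_succ, sigmaBracket_add_one, Nat.cast_zero, sigmaBracket_zero,
      scaleVar_one_right, h, one_mul, mul_one]
  | succ m ih =>
    rw [Nat.cast_succ] at ih
    rw [Nat.cast_succ (m + 1), sigmaBracket_add_one, Nat.cast_succ m]
    conv_rhs => rw [sigmaBracket_add_one]
    rw [ih, scaleVar_mul, scaleVar_scaleVar, mul_assoc, add_comm (m : ℤ) 1, zpow_add, zpow_one,
      Units.val_mul]

theorem completeBracket_zero_left (q : Rˣ) (m : ℤ) : completeBracket q 0 m = 1 := by
  have step : ∀ m : ℤ, completeBracket q 0 (m + 1) = completeBracket q 0 m := by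
    intro m
    unfold completeBracket
    rw [sigmaBracket_add_one, coeff_mul, Finset.Nat.antidiagonal_zero, Finset.sum_singleton,
      coeff_scaleVar, pow_zero, one_smul, coeff_sigma, complete, mul_one]
  induction m using Int.induction_on with
  | zero => rw [completeBracket, sigmaBracket_zero, coeff_zero_one]
  | succ m ih => rw [step, ih]
  | pred m ih => rw [← step, sub_add_cancel, ih]

theorem completeBracket_add_one (q : Rˣ) (N : ℕ) (m : ℤ) :
    completeBracket q N (m + 1) = ∑ p ∈ antidiagonal N,
      ((q ^ (m * p.2) : Rˣ) : R) • (completeBracket q p.1 m * complete R p.2) := by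
  unfold completeBracket
  rw [sigmaBracket_add_one, coeff_mul]
  refine Finset.sum_congr rfl fun p _ => ?_
  rw [coeff_scaleVar, coeff_sigma, mul_smul_comm, zpow_mul, zpow_natCast, Units.val_pow_eq_pow_val]

theorem completeBracket_natCast_succ (q : Rˣ) (N m : ℕ) :
    completeBracket q N ((m + 1 : ℕ) : ℤ) = ∑ p ∈ antidiagonal N,
      (q : R) ^ p.2 • (complete R p.1 * completeBracket q p.2 m) := by
  unfold completeBracket
  rw [sigmaBracket_natCast_succ, coeff_mul]
  refine Finset.sum_congr rfl fun p _ => ?_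
  rw [coeff_scaleVar, coeff_sigma, mul_smul_comm]

/-! ### First-passage decomposition -/

theorem sum_antidiagonal_assoc {A : Type*} [AddCommMonoid A] (N : ℕ) (f : ℕ → ℕ → ℕ → A) :
    ∑ p ∈ antidiagonal N, ∑ r ∈ antidiagonal p.1, f r.1 r.2 p.2 =
      ∑ p ∈ antidiagonal N, ∑ r ∈ antidiagonal p.2, f p.1 r.1 r.2 := by
  rw [Finset.sum_sigma', Finset.sum_sigma']
  refine Finset.sum_nbij' (fun x => ⟨(x.2.1, x.2.2 + x.1.2), (x.2.2, x.1.2)⟩)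
    (fun x => ⟨(x.1.1 + x.2.1, x.2.2), (x.1.1, x.2.1)⟩) ?_ ?_ ?_ ?_ ?_
  · rintro ⟨⟨a, b⟩, ⟨c, d⟩⟩ hx
    simp only [Finset.mem_sigma, mem_antidiagonal] at hx ⊢
    exact ⟨by omega, trivial⟩
  · rintro ⟨⟨a, b⟩, ⟨c, d⟩⟩ hx
    simp only [Finset.mem_sigma, mem_antidiagonal] at hx ⊢
    exact ⟨by omega, trivial⟩
  · rintro ⟨⟨a, b⟩, ⟨c, d⟩⟩ hx
    simp only [Finset.mem_sigma, mem_antidiagonal] at hx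
    simp only [Sigma.mk.injEq, Prod.mk.injEq, heq_eq_eq, and_true]
    omega
  · rintro ⟨⟨a, b⟩, ⟨c, d⟩⟩ hx
    simp only [Finset.mem_sigma, mem_antidiagonal] at hx
    simp only [Sigma.mk.injEq, Prod.mk.injEq, heq_eq_eq, and_true, true_and]
    omega
  · intro x _
    rfl

/-- Decomposition of a lattice path at its first passage below the diagonal. -/
theorem completeBracket_eq_sum_pathSum (q : Rˣ) (L M h : ℕ) (hL : M + h = L) :
    completeBracket q M ((L + 1 : ℕ) : ℤ) = ∑ p ∈ antidiagonal M,
      (q : R) ^ ((p.1 + h + 1) * p.2) •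
        (pathSum (q : R) (p.1 + h) p.1 h * completeBracket q p.2 (p.2 : ℤ)) := by
  induction L generalizing M h with
  | zero =>
    obtain ⟨rfl, rfl⟩ : M = 0 ∧ h = 0 := by omega
    simp [completeBracket_zero_left, pathSum]
  | succ L ih =>
    -- The first entry `c` is split off. The path continues from height `h + c - 1`, and every later
    -- entry gains a factor `q`.
    rw [completeBracket_natCast_succ]
    match M, h, hL with
    | M, h + 1, hL =>
      have e1 : ∀ p ∈ antidiagonal M,
          (q : R) ^ p.2 • (complete R p.1 * completeBracket q p.2 ((L + 1 : ℕ) : ℤ)) =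
          ∑ r ∈ antidiagonal p.2, (q : R) ^ (r.1 + (p.1 + r.1 + (h + 1) + 1) * r.2) •
            (complete R p.1 * pathSum (q : R) (p.1 + r.1 + h) r.1 (h + p.1) *
              completeBracket q r.2 (r.2 : ℤ)) := by
        intro p hp
        have hp' := mem_antidiagonal.1 hp
        rw [ih p.2 (h + p.1) (by omega), Finset.mul_sum, Finset.smul_sum]
        refine Finset.sum_congr rfl fun r hr => ?_
        have hr' := mem_antidiagonal.1 hr
        rw [mul_smul_comm, smul_smul, ← pow_add, ← mul_assoc, ← hr',
          show r.1 + (h + p.1) = p.1 + r.1 + h by ring]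
        congr 2
        ring
      rw [Finset.sum_congr rfl e1, ← sum_antidiagonal_assoc M (fun a b k =>
        (q : R) ^ (b + (a + b + (h + 1) + 1) * k) •
            (complete R a * pathSum (q : R) (a + b + h) b (h + a) *
              completeBracket q k (k : ℤ)))]
      refine Finset.sum_congr rfl fun p hp => ?_
      rw [← Nat.add_assoc p.1 h 1, pathSum, Finset.sum_mul, Finset.smul_sum]
      refine Finset.sum_congr rfl fun r hr => ?_
      rw [← mem_antidiagonal.1 hr, smul_mul_assoc, smul_smul, ← pow_add]
      congr 2
      ring
    | M + 1, 0, hL =>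
      -- At height `0` a first entry `0` falls below the diagonal at once. It matches the term `p.1
      -- = 0` on the right, whose path is empty; positive first entries are treated by induction.
      rw [Finset.Nat.sum_antidiagonal_succ, Finset.Nat.sum_antidiagonal_succ]
      have hM : M = L := by omega
      congr 1
      · subst hM
        simp [pathSum, complete]
      · have e1 : ∀ p ∈ antidiagonal M,
            (q : R) ^ p.2 • (complete R (p.1 + 1) * completeBracket q p.2 ((L + 1 : ℕ) : ℤ)) =
            ∑ r ∈ antidiagonal p.2, (q : R) ^ (r.1 + (p.1 + r.1 + 1 + 1) * r.2) •
              (complete R (p.1 + 1) * pathSum (q : R) (p.1 + r.1) r.1 p.1 *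
                completeBracket q r.2 (r.2 : ℤ)) := by
          intro p hp
          have hp' := mem_antidiagonal.1 hp
          rw [ih p.2 p.1 (by omega), Finset.mul_sum, Finset.smul_sum]
          refine Finset.sum_congr rfl fun r hr => ?_
          have hr' := mem_antidiagonal.1 hr
          rw [mul_smul_comm, smul_smul, ← pow_add, ← mul_assoc, ← hr', add_comm r.1 p.1]
          congr 2
          ring
        rw [Finset.sum_congr rfl e1, ← sum_antidiagonal_assoc M (fun a b k =>
          (q : R) ^ (b + (a + b + 1 + 1) * k) •
              (complete R (a + 1) * pathSum (q : R) (a + b) b a *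
                completeBracket q k (k : ℤ)))]
        refine Finset.sum_congr rfl fun p hp => ?_
        rw [Nat.add_zero, pathSum, Finset.sum_mul, Finset.smul_sum]
        refine Finset.sum_congr rfl fun r hr => ?_
        rw [← mem_antidiagonal.1 hr, smul_mul_assoc, smul_smul, ← pow_add]
        congr 2
        ring

/-- The difference of the two sides of the recursion for the characteristics of the modules of
parking functions. -/
def parkingDefect (q : Rˣ) (r : ℤ) (N : ℕ) : NSym R :=
  completeBracket q N (N + r) - ∑ p ∈ antidiagonal N, (q : R) ^ ((p.1 + 1) * p.2) •
    (parkingChar (q : R) p.1 * completeBracket q p.2 (p.2 + r - 1))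

/-- First-passage decomposition for paths that start at height `0`. -/
theorem parkingDefect_one (q : Rˣ) (N : ℕ) : parkingDefect q 1 N = 0 := by
  have h := completeBracket_eq_sum_pathSum q N N 0 rfl
  rw [Nat.cast_succ] at h
  rw [parkingDefect, sub_eq_zero, h]
  refine Finset.sum_congr rfl fun p _ => ?_
  simp only [parkingChar_eq_pathSum, add_sub_cancel_right, Nat.add_zero]

/-- Both terms of the defect are expanded by the recursion that multiplies on the right, so the left
factors `parkingChar` are untouched. In degree `p.1` the shift becomes `r + p.2`, because `N + r =
p.1 + (r + p.2)`. -/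
theorem parkingDefect_add_one (q : Rˣ) (r : ℤ) (N : ℕ) :
    parkingDefect q (r + 1) N = ∑ p ∈ antidiagonal N,
      ((q ^ ((N + r) * p.2) : Rˣ) : R) • (parkingDefect q (r + p.2) p.1 * complete R p.2) := by
  unfold parkingDefect
  simp only [sub_mul, smul_sub, Finset.sum_sub_distrib]
  congr 1
  · rw [← add_assoc, completeBracket_add_one]
    refine Finset.sum_congr rfl fun p hp => ?_
    have hp' : (p.1 : ℤ) + p.2 = N := by exact_mod_cast mem_antidiagonal.1 hp
    rw [← hp', show (p.1 : ℤ) + p.2 + r = p.1 + (r + p.2) by ring]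
  · have e1 : ∀ p ∈ antidiagonal N, (q : R) ^ ((p.1 + 1) * p.2) •
        (parkingChar (q : R) p.1 * completeBracket q p.2 (p.2 + (r + 1) - 1)) =
        ∑ s ∈ antidiagonal p.2, ((q ^ ((((p.1 + 1) * (s.1 + s.2) : ℕ) : ℤ) +
          (s.1 + s.2 + r - 1) * s.2) : Rˣ) : R) • (parkingChar (q : R) p.1 *
            completeBracket q s.1 (s.1 + s.2 + r - 1) * complete R s.2) := by
      intro p _
      rw [show (p.2 : ℤ) + (r + 1) - 1 = (p.2 + r - 1) + 1 by ring, completeBracket_add_one,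
        Finset.mul_sum, Finset.smul_sum]
      refine Finset.sum_congr rfl fun s hs => ?_
      have hs' : (s.1 : ℤ) + s.2 = p.2 := by exact_mod_cast mem_antidiagonal.1 hs
      rw [mul_smul_comm, smul_smul, ← mul_assoc, hs', mem_antidiagonal.1 hs, zpow_add,
        zpow_natCast, Units.val_mul, Units.val_pow_eq_pow_val]
    rw [Finset.sum_congr rfl e1, ← sum_antidiagonal_assoc N (fun a b c =>
      ((q ^ ((((a + 1) * (b + c) : ℕ) : ℤ) + (b + c + r - 1) * c) : Rˣ) : R) •
        (parkingChar (q : R) a * completeBracket q b (b + c + r - 1) * complete R c))]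
    refine Finset.sum_congr rfl fun p hp => ?_
    rw [Finset.sum_mul, Finset.smul_sum]
    refine Finset.sum_congr rfl fun s hs => ?_
    have hp' : (p.1 : ℤ) + p.2 = N := by exact_mod_cast mem_antidiagonal.1 hp
    have hs' : (s.1 : ℤ) + s.2 = p.1 := by exact_mod_cast mem_antidiagonal.1 hs
    rw [smul_mul_assoc, smul_smul, ← Units.val_pow_eq_pow_val, ← Units.val_mul, ← zpow_natCast,
      ← zpow_add, show (s.2 : ℤ) + (r + p.2) - 1 = s.2 + p.2 + r - 1 by ring]
    congr 3
    rw [← hp', ← hs']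
    push_cast
    ring

/-- With the lower degrees zero for all shifts, only the term `(N, 0)` of the recursion survives.
The defect in degree `N` is then independent of `r`, hence equal to its value `0` at `r = 1`. -/
theorem parkingDefect_eq_zero (q : Rˣ) (N : ℕ) : ∀ r : ℤ, parkingDefect q r N = 0 := by
  induction N using Nat.strong_induction_on with
  | _ N ih =>
    have step : ∀ r : ℤ, parkingDefect q (r + 1) N = parkingDefect q r N := by
      intro r
      rw [parkingDefect_add_one, Finset.sum_eq_single (N, 0)]
      · simp [complete]
      · intro p hp hne
        have hp' := mem_antidiagonal.1 hp
        have : p.1 < N := by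
          by_contra! h
          exact hne (Prod.ext (by simp only; omega) (by simp only; omega))
        rw [ih p.1 this, zero_mul, smul_zero]
      · intro h
        exact absurd (mem_antidiagonal.2 (by simp)) h
    have hz : ∀ r : ℤ, parkingDefect q (1 + r) N = 0 := by
      intro r
      induction r using Int.induction_on with
      | zero => rw [add_zero, parkingDefect_one]
      | succ m ih' => rw [← add_assoc, step, ih']
      | pred m ih' => rw [← step, add_assoc, sub_add_cancel, ih']
    intro r
    rw [← add_sub_cancel 1 r, hz]

/-! ### Assembly of the generating series -/

theorem choose_two_add (n k : ℕ) :
    n + k + (n + k).choose 2 = (n + 1).choose 2 + k.choose 2 + (n + 1) * k := by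
  induction k with
  | zero => simp [Nat.choose_succ_succ' n 1]
  | succ k ih =>
    rw [← Nat.add_assoc, Nat.choose_succ_succ' (n + k) 1, Nat.choose_succ_succ' k 1,
      Nat.choose_one_right, Nat.choose_one_right, Nat.mul_succ]
    simp only [Nat.reduceAdd]
    omega

theorem isUnit_seriesF (q : Rˣ) (r : ℤ) : IsUnit (seriesF q r) :=
  isUnit_of_coeff_zero (by
    rw [seriesF, coeff_mk, completeBracket_zero_left]
    simp)

theorem seriesG_mul_seriesF (q : Rˣ) (r : ℤ) :
    seriesG q * seriesF q (r - 1) = scaleVar ((q⁻¹ : Rˣ) : R) (seriesF q r) := by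
  ext N
  unfold seriesG seriesF
  rw [coeff_mul, coeff_scaleVar, coeff_mk,
    sub_eq_zero.1 (parkingDefect_eq_zero q N r), Finset.smul_sum, Finset.smul_sum]
  refine Finset.sum_congr rfl fun p hp => ?_
  have hp' := mem_antidiagonal.1 hp
  rw [coeff_mk, coeff_mk, smul_mul_smul_comm, smul_smul, smul_smul,
    add_sub_assoc]
  congr 1
  -- By `choose_two_add` the normalizing exponents on the two sides differ by exactly `(p.1 + 1) *
  -- p.2`, the exponent in the recursion.
  simp only [← Units.val_pow_eq_pow_val, ← Units.val_mul]
  rw [← pow_add, ← pow_add, ← hp', choose_two_add, pow_add _ _ ((p.1 + 1) * p.2),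
    mul_assoc, inv_pow q ((p.1 + 1) * p.2), inv_mul_cancel, mul_one]

end Series

end ParkingHecke

end

theorem mainTheorem1 {R : Type*} [CommRing R] (q : Rˣ) :
    (∀ n d : ℕ, Module.Projective (ParkingHecke.HeckeZero n)ᵐᵒᵖ
      (ParkingHecke.parkingModule n d)) ∧
    ∀ r : ℤ, IsUnit (ParkingHecke.seriesF q (r - 1)) ∧
      ParkingHecke.seriesG q =
        ParkingHecke.scaleVar ((q⁻¹ : Rˣ) : R) (ParkingHecke.seriesF q r) *
          Ring.inverse (ParkingHecke.seriesF q (r - 1)) := by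
  refine ⟨fun n d => ParkingHecke.permutational_projective _ _, fun r => ?_⟩
  have hu := ParkingHecke.isUnit_seriesF q (r - 1)
  refine ⟨hu, ?_⟩
  rw [← ParkingHecke.seriesG_mul_seriesF, mul_assoc, Ring.mul_inverse_cancel _ hu, mul_one]
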